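/- All graphs are finite, undirected and simple. A *matching cut* of a graph $G$ is a (possibly empty) set $M\subseteq E(G)$ such that no two edges of $M$ share an end-vertex and $M=E_G(A,B)$ for some partition $\{A,B\}$ of $V(G)$ into two nonempty sets, where $E_G(A,B)$ is the set of edges of $G$ with one end in $A$ and the other in $B$. A matching cut of $G$ is *minimal* (*maximal*) if no matching cut of $G$ is a proper subset (proper superset) of it. Let $\tau(G)$ be the vertex cover number of $G$, i.e. the minimum size of a set of vertices meeting every edge. An *enumeration algorithm* for a family of edge sets is a deterministic algorithm (a program for a random access machine with logarithmic cost) that, given the adjacency matrix of an $n$-vertex graph $G$ (with vertices numbered $0,\dots,n-1$), outputs exactly the members of the family belonging to $G$, without duplicates, and halts. Its *delay* on $G$ is the maximum of the times from the start to the first output, between consecutive outputs, and from the last output to the end (from the start to the end if there is no output). **Theorem.** 1. The minimal matching cuts of an $n$-vertex graph $G$ can be enumerated in total time $2^{O(\tau(G))}\cdot n^{O(1)}$. 2. All matching cuts of an $n$-vertex graph $G$ can be enumerated with delay $2^{O(\tau(G))}\cdot n^{O(1)}$. 3. The maximal matching cuts of an $n$-vertex graph $G$ can be enumerated with delay $2^{O(\tau(G))}\cdot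 n^{O(1)}$. In each case this means that there are one program $P$, a constant $c\in\mathbb{N}$ and a polynomial $p$ with nonnegative integer coefficients such that, for all $n$ and all $n$-vertex graphs $G$, the total time (respectively the delay) of $P$ on $G$ is at most $2^{c\,\tau(G)}\cdot p(n)$. -/

import Mathlib

/-! ## Matching cuts -/

namespace SimpleGraph

variable {V : Type*}

/-- The set `E_G(A, B)` of edges of `G` with one end in `A` and the other end in `B`. -/
def edgesBetween (G : SimpleGraph V) (A B : Set V) : Set (Sym2 V) :=
  {e | ∃ u ∈ A, ∃ v ∈ B, G.Adj u v ∧ e = s(u, v)}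

/-- `M` is an edge cut of `G`: it is the set of edges between the two (nonempty) classes of a
partition `{A, V \ A}` of the vertex set. -/
def IsEdgeCut (G : SimpleGraph V) (M : Set (Sym2 V)) : Prop :=
  ∃ A : Set V, A.Nonempty ∧ Aᶜ.Nonempty ∧ M = G.edgesBetween A Aᶜ

/-- No two distinct members of the edge set `M` share an end-vertex (the empty set is allowed). -/
def IsMatchingEdgeSet (M : Set (Sym2 V)) : Prop :=
  ∀ e ∈ M, ∀ f ∈ M, ∀ v : V, v ∈ e → v ∈ f → e = f

/-- A matching cut is a (possibly empty) set of edges that is an edge cut and a matching. -/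
def IsMatchingCut (G : SimpleGraph V) (M : Set (Sym2 V)) : Prop :=
  G.IsEdgeCut M ∧ IsMatchingEdgeSet M

end SimpleGraph

/-! ## A random access machine with logarithmic cost

Programs are written in structured form (`while`-programs). The memory consists of arrays of natural
numbers, named by the numerals `0, 1, 2, …`; the name of an array is fixed in the text of the
program, so a program uses finitely many arrays, while the index is computed. A scalar variable is an
array that is only used at index `0`. -/

namespace RAM

/-- The arithmetic operations (on natural numbers; subtraction is truncated). -/
inductive Op
  | add | sub | mul | div | mod

def Op.eval : Op → ℕ → ℕ → ℕ
  | .add, a, b => a + b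
  | .sub, a, b => a - b
  | .mul, a, b => a * b
  | .div, a, b => a / b
  | .mod, a, b => a % b

/-- Expressions: constants, array access `a[i]`, arithmetic. -/
inductive Expr
  | lit (v : ℕ)
  | get (a : ℕ) (i : Expr)
  | bin (o : Op) (e f : Expr)

/-- Contents of the memory: array name, then index, then value. -/
abbrev Mem := ℕ → ℕ → ℕ

def Expr.eval (m : Mem) : Expr → ℕ
  | .lit v => v
  | .get a i => m a (i.eval m)
  | .bin o e f => o.eval (e.eval m) (f.eval m)

/-- Logarithmic cost of evaluating an expression: every constant, memory access and arithmetic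
operation costs one plus the bit length of its value (the bit lengths of indices and operands are
charged where these are evaluated). -/
def Expr.cost (m : Mem) : Expr → ℕ
  | .lit v => 1 + Nat.size v
  | .get a i => i.cost m + 1 + Nat.size (m a (i.eval m))
  | .bin o e f => e.cost m + f.cost m + 1 + Nat.size (o.eval (e.eval m) (f.eval m))

/-- Programs. `write e` appends the value of `e` to the solution being written; `emit` outputs the
solution written so far and starts a new, empty one. -/
inductive Cmd
  | skip
  | set (a : ℕ) (i e : Expr)
  | seq (c d : Cmd)
  | ite (e : Expr) (c d : Cmd)
  | loop (e : Expr) (c : Cmd)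
  | write (e : Expr)
  | emit

/-- A configuration: the memory, the solution being written, the solutions output so far in order,
each with the time of its output, and the clock. -/
structure State where
  mem : Mem
  buf : List ℕ
  out : List (ℕ × List ℕ)
  time : ℕ

/-- Let `t` units of time pass. -/
def State.tick (σ : State) (t : ℕ) : State := { σ with time := σ.time + t }

def Mem.update (m : Mem) (a i v : ℕ) : Mem := fun b j => if b = a ∧ j = i then v else m b j

/-- `c.Runs σ σ'`: the program `c`, started in the configuration `σ`, halts in `σ'`. The test of
`ite` and `loop` succeeds when the value is nonzero. -/
inductive Cmd.Runs : Cmd → State → State → Prop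
  | skip (σ : State) : Cmd.Runs .skip σ (σ.tick 1)
  | set (a : ℕ) (i e : Expr) (σ : State) :
      Cmd.Runs (.set a i e) σ
        { σ.tick (1 + i.cost σ.mem + e.cost σ.mem) with
          mem := Mem.update σ.mem a (i.eval σ.mem) (e.eval σ.mem) }
  | seq {c d : Cmd} {σ σ₁ σ₂ : State} :
      Cmd.Runs c σ σ₁ → Cmd.Runs d σ₁ σ₂ → Cmd.Runs (.seq c d) σ σ₂
  | ite_true {e : Expr} {c d : Cmd} {σ σ₁ : State} : e.eval σ.mem ≠ 0 →
      Cmd.Runs c (σ.tick (1 + e.cost σ.mem)) σ₁ → Cmd.Runs (.ite e c d) σ σ₁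
  | ite_false {e : Expr} {c d : Cmd} {σ σ₁ : State} : e.eval σ.mem = 0 →
      Cmd.Runs d (σ.tick (1 + e.cost σ.mem)) σ₁ → Cmd.Runs (.ite e c d) σ σ₁
  | loop_done {e : Expr} {c : Cmd} {σ : State} : e.eval σ.mem = 0 →
      Cmd.Runs (.loop e c) σ (σ.tick (1 + e.cost σ.mem))
  | loop_step {e : Expr} {c : Cmd} {σ σ₁ σ₂ : State} : e.eval σ.mem ≠ 0 →
      Cmd.Runs c (σ.tick (1 + e.cost σ.mem)) σ₁ → Cmd.Runs (.loop e c) σ₁ σ₂ →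
      Cmd.Runs (.loop e c) σ σ₂
  | write (e : Expr) (σ : State) :
      Cmd.Runs (.write e) σ
        { σ.tick (1 + e.cost σ.mem) with buf := σ.buf ++ [e.eval σ.mem] }
  | emit (σ : State) :
      Cmd.Runs .emit σ { σ.tick 1 with buf := [], out := σ.out ++ [(σ.time + 1, σ.buf)] }

/-- The machine is deterministic. -/
theorem Cmd.Runs.unique {c : Cmd} {σ σ₁ σ₂ : State} (h₁ : c.Runs σ σ₁) (h₂ : c.Runs σ σ₂) :
    σ₁ = σ₂ := by
  induction h₁ generalizing σ₂ with
  | seq _ _ ihc ihd =>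
    cases h₂ with
    | seq k₁ k₂ => have := ihc k₁; subst this; exact ihd k₂
  | loop_step h _ _ ihc ihd =>
    cases h₂ with
    | loop_done h' => exact absurd h' h
    | loop_step _ k₁ k₂ => have := ihc k₁; subst this; exact ihd k₂
  | _ => cases h₂ <;> grind

/-! ### Enumeration of edge sets of a graph -/

open Classical in
/-- The input: array `0` holds the number `n` of vertices (at index `0`), array `1` holds the
adjacency matrix of `G`, row by row, and everything else is zero. -/
noncomputable def inputMem {n : ℕ} (G : SimpleGraph (Fin n)) : Mem := fun a i =>
  if a = 0 ∧ i = 0 then n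
  else if a = 1 ∧ ∃ u v : Fin n, G.Adj u v ∧ i = (u : ℕ) * n + (v : ℕ) then 1
  else 0

noncomputable def initState {n : ℕ} (G : SimpleGraph (Fin n)) : State where
  mem := inputMem G
  buf := []
  out := []
  time := 0

/-- The word `w = u₁ v₁ u₂ v₂ …` lists the edges `u₁v₁, u₂v₂, …` of `M`, each exactly once, in some
order. -/
def ListsEdges {n : ℕ} (w : List ℕ) (M : Set (Sym2 (Fin n))) : Prop :=
  ∃ l : List (Fin n × Fin n), w = l.flatMap (fun p => [(p.1 : ℕ), (p.2 : ℕ)]) ∧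
    (l.map fun p => s(p.1, p.2)).Nodup ∧ M = {e | e ∈ l.map fun p => s(p.1, p.2)}

/-- `P`, started on the input `G`, halts at time `T`, having output exactly the members of `S`,
without duplicates, at the times `ts` (in order). -/
def Enumerates {n : ℕ} (P : Cmd) (G : SimpleGraph (Fin n)) (S : Set (Set (Sym2 (Fin n))))
    (ts : List ℕ) (T : ℕ) : Prop :=
  ∃ σ : State, P.Runs (initState G) σ ∧ σ.time = T ∧ σ.out.map Prod.fst = ts ∧
    ∃ Ms : List (Set (Sym2 (Fin n))),
      Ms.Nodup ∧ (∀ M, M ∈ Ms ↔ M ∈ S) ∧ List.Forall₂ ListsEdges (σ.out.map Prod.snd) Ms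

/-- `P` enumerates `S` on the input `G` in total time at most `t`. -/
def EnumeratesInTime {n : ℕ} (P : Cmd) (G : SimpleGraph (Fin n)) (S : Set (Set (Sym2 (Fin n))))
    (t : ℕ) : Prop :=
  ∃ ts T, Enumerates P G S ts T ∧ T ≤ t

/-- `P` enumerates `S` on the input `G` with delay at most `d`: at most `d` units of time pass from
the start to the first output, between consecutive outputs, and from the last output to the end
(from the start to the end, if there is no output). -/
def EnumeratesWithDelay {n : ℕ} (P : Cmd) (G : SimpleGraph (Fin n)) (S : Set (Set (Sym2 (Fin n))))
    (d : ℕ) : Prop :=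
  ∃ ts T, Enumerates P G S ts T ∧ List.IsChain (fun s t => t ≤ s + d) (0 :: (ts ++ [T]))

end RAM

/-! ## Polynomial bounds -/

/-- `t` is bounded by a polynomial. -/
@[fun_prop]
def PolyBounded (t : ℕ → ℕ) : Prop := ∃ C, ∀ B, t B ≤ (B + 2) ^ C

namespace PolyBounded

@[fun_prop]
theorem id : PolyBounded (fun B => B) := ⟨1, fun B => by simp⟩

@[fun_prop]
theorem const (c : ℕ) : PolyBounded (fun _ => c) :=
  ⟨c, fun B => Nat.lt_two_pow_self.le.trans (Nat.pow_le_pow_left (by omega) c)⟩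

@[fun_prop]
theorem add {s t : ℕ → ℕ} (hs : PolyBounded s) (ht : PolyBounded t) :
    PolyBounded (fun B => s B + t B) := by
  obtain ⟨a, ha⟩ := hs
  obtain ⟨b, hb⟩ := ht
  refine ⟨a + b + 1, fun B => ?_⟩
  have h1 : (B + 2) ^ a ≤ (B + 2) ^ (a + b) := Nat.pow_le_pow_right (by omega) (by omega)
  have h2 : (B + 2) ^ b ≤ (B + 2) ^ (a + b) := Nat.pow_le_pow_right (by omega) (by omega)
  have := ha B
  have := hb B
  rw [pow_succ]
  nlinarith

@[fun_prop]
theorem mul {s t : ℕ → ℕ} (hs : PolyBounded s) (ht : PolyBounded t) :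
    PolyBounded (fun B => s B * t B) := by
  obtain ⟨a, ha⟩ := hs
  obtain ⟨b, hb⟩ := ht
  exact ⟨a + b, fun B => by rw [pow_add]; exact Nat.mul_le_mul (ha B) (hb B)⟩

@[fun_prop]
theorem comp {s t : ℕ → ℕ} (hs : PolyBounded s) (ht : PolyBounded t) :
    PolyBounded (fun B => s (t B)) := by
  obtain ⟨a, ha⟩ := hs
  -- The added 2 absorbs the shift in the base of the bound for `s`.
  obtain ⟨b, hb⟩ := ht.add (const 2)
  exact ⟨b * a, fun B => (ha _).trans (by rw [pow_mul]; exact Nat.pow_le_pow_left (hb B) a)⟩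

end PolyBounded

/-! ### Bit lengths of sums and products -/

theorem Nat.size_le_self (a : ℕ) : Nat.size a ≤ a := Nat.size_le.2 Nat.lt_two_pow_self

theorem Nat.size_add_le (a b : ℕ) : Nat.size (a + b) ≤ Nat.size a + Nat.size b + 1 := by
  rw [Nat.size_le]
  have ha := Nat.lt_size_self a
  have hb := Nat.lt_size_self b
  have h1 : 2 ^ a.size ≤ 2 ^ (a.size + b.size) := Nat.pow_le_pow_right (by omega) (by omega)
  have h2 : 2 ^ b.size ≤ 2 ^ (a.size + b.size) := Nat.pow_le_pow_right (by omega) (by omega)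
  rw [pow_succ]
  omega

theorem Nat.size_mul_le (a b : ℕ) : Nat.size (a * b) ≤ Nat.size a + Nat.size b := by
  rw [Nat.size_le, pow_add]
  exact Nat.mul_lt_mul'' (Nat.lt_size_self a) (Nat.lt_size_self b)

/-! ### Operations, assignments and states of the machine -/

namespace RAM

theorem Op.size_eval_le (o : Op) (a b : ℕ) : Nat.size (o.eval a b) ≤ Nat.size a + Nat.size b + 1 := by
  cases o with
  | add => exact Nat.size_add_le a b
  | sub => exact (Nat.size_le_size (Nat.sub_le a b)).trans (by omega)
  | mul => exact (Nat.size_mul_le a b).trans (by omega)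
  | div => exact (Nat.size_le_size (Nat.div_le_self a b)).trans (by omega)
  | mod => exact (Nat.size_le_size (Nat.mod_le a b)).trans (by omega)

@[simp]
theorem Mem.update_self (m : Mem) (a i v : ℕ) : Mem.update m a i v a i = v := by
  simp [Mem.update]

theorem Mem.update_of_ne (m : Mem) {a b : ℕ} (i v : ℕ) (h : b ≠ a) :
    Mem.update m a i v b = m b := by
  funext j
  simp [Mem.update, h]

@[simp] theorem State.tick_mem (σ : State) (t : ℕ) : (σ.tick t).mem = σ.mem := rfl
@[simp] theorem State.tick_buf (σ : State) (t : ℕ) : (σ.tick t).buf = σ.buf := rfl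
@[simp] theorem State.tick_out (σ : State) (t : ℕ) : (σ.tick t).out = σ.out := rfl
@[simp] theorem State.tick_time (σ : State) (t : ℕ) : (σ.tick t).time = σ.time + t := rfl

/-- The scalar stored in array `a`. -/
abbrev Expr.reg (a : ℕ) : Expr := .get a (.lit 0)

/-- The state after an assignment of `v` to the scalar `a` in time `t`. -/
def State.assign (σ : State) (a v t : ℕ) : State :=
  { σ.tick t with mem := σ.mem.update a 0 v }

@[simp] theorem State.assign_mem (σ : State) (a v t : ℕ) :
    (σ.assign a v t).mem = σ.mem.update a 0 v := rfl
@[simp] theorem State.assign_buf (σ : State) (a v t : ℕ) : (σ.assign a v t).buf = σ.buf := rfl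
@[simp] theorem State.assign_out (σ : State) (a v t : ℕ) : (σ.assign a v t).out = σ.out := rfl
@[simp] theorem State.assign_time (σ : State) (a v t : ℕ) :
    (σ.assign a v t).time = σ.time + t := rfl

theorem Cmd.Runs.assign {σ : State} {e : Expr} {v t : ℕ} (a : ℕ) (hv : e.eval σ.mem = v)
    (ht : 2 + e.cost σ.mem = t) : Cmd.Runs (.set a (.lit 0) e) σ (σ.assign a v t) := by
  subst hv ht
  exact Cmd.Runs.set a (.lit 0) e σ

theorem Expr.eval_reg {m : Mem} {a v : ℕ} (h : m a 0 = v) : (Expr.reg a).eval m = v := h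

theorem Expr.cost_reg {m : Mem} {a v : ℕ} (h : m a 0 = v) :
    (Expr.reg a).cost m = 2 + Nat.size v := by
  simp [Expr.cost, Expr.eval, h]

/-! ## Feasible functions -/

/-- An input graph. -/
structure Inst where
  n : ℕ
  G : SimpleGraph (Fin n)

/-- The parameter in which the running times are polynomial. -/
noncomputable def Inst.scale (I : Inst) : ℕ := I.n + 2 ^ (4 * I.G.vertexCoverNum.toNat)

/-- Values of the variables. -/
abbrev Env := ℕ → ℕ

/-- Extend an environment by the value of a new variable, which gets the number `0`. -/
def Env.cons (a : ℕ) (e : Env) : Env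
  | 0 => a
  | i + 1 => e i

@[simp] theorem Env.cons_zero (a : ℕ) (e : Env) : Env.cons a e 0 = a := rfl
@[simp] theorem Env.cons_succ (a : ℕ) (e : Env) (i : ℕ) : Env.cons a e (i + 1) = e i := rfl
@[simp] theorem Env.cons_one (a : ℕ) (e : Env) : Env.cons a e 1 = e 0 := rfl
@[simp] theorem Env.cons_two (a : ℕ) (e : Env) : Env.cons a e 2 = e 1 := rfl

/-- `B` bounds the scale of the input and the bit lengths of the variables. -/
def Fits (I : Inst) (e : Env) (B : ℕ) : Prop := I.scale ≤ B ∧ ∀ i, Nat.size (e i) ≤ B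

theorem Fits.mono {I : Inst} {e : Env} {B B' : ℕ} (h : Fits I e B) (hB : B ≤ B') : Fits I e B' :=
  ⟨h.1.trans hB, fun i => (h.2 i).trans hB⟩

theorem Fits.cons {I : Inst} {e : Env} {B a : ℕ} (h : Fits I e B) (ha : Nat.size a ≤ B) :
    Fits I (e.cons a) B := by
  refine ⟨h.1, fun i => ?_⟩
  cases i with
  | zero => exact ha
  | succ i => exact h.2 i

theorem Fits.n_le {I : Inst} {e : Env} {B : ℕ} (h : Fits I e B) : I.n ≤ B :=
  le_trans (Nat.le_add_right _ _) h.1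

/-- The memory holds the input graph. -/
def Holds (I : Inst) (m : Mem) : Prop := m 0 = inputMem I.G 0 ∧ m 1 = inputMem I.G 1

theorem Holds.of_eq {I : Inst} {m m' : Mem} {d : ℕ} (h : Holds I m) (hd : 2 ≤ d)
    (hm : ∀ a < d, m' a = m a) : Holds I m' :=
  ⟨(hm 0 (by omega)).trans h.1, (hm 1 (by omega)).trans h.2⟩

theorem Holds.n_eq {I : Inst} {m : Mem} (h : Holds I m) : m 0 0 = I.n := by
  simp [h.1, inputMem]

/-- Started at `σ`, the program `c` puts the value `v` into array `d` in time at most `t` without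
changing the arrays below `d` and without output. -/
def Computes (c : Cmd) (d : ℕ) (σ : State) (v t : ℕ) : Prop :=
  ∃ σ', c.Runs σ σ' ∧ σ'.mem d 0 = v ∧ (∀ a < d, σ'.mem a = σ.mem a) ∧ σ'.buf = σ.buf ∧
    σ'.out = σ.out ∧ σ'.time ≤ σ.time + t

/-- `f` can be computed in polynomial time in the scale of the input and the bit lengths of the
variables, by code that reads the variables from given arrays `ρ i < d`. -/
def Feasible (f : Inst → Env → ℕ) : Prop :=
  ∃ (code : (ℕ → ℕ) → ℕ → Cmd) (t : ℕ → ℕ), PolyBounded t ∧ ∀ I e B, Fits I e B →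
    Nat.size (f I e) ≤ t B ∧ ∀ ρ d σ, 2 ≤ d → (∀ i, ρ i < d) → Holds I σ.mem →
      (∀ i, σ.mem (ρ i) 0 = e i) → Computes (code ρ d) d σ (f I e) (t B)

/-- The value of `f` itself (not only its bit length) is polynomially bounded. -/
def Small (f : Inst → Env → ℕ) : Prop :=
  ∃ t, PolyBounded t ∧ ∀ I e B, Fits I e B → f I e ≤ t B

namespace Feasible

theorem const (c : ℕ) : Feasible (fun _ _ => c) := by
  refine ⟨fun _ d => .set d (.lit 0) (.lit c), fun _ => c + 3, by fun_prop, fun I e B _ =>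
    ⟨(Nat.size_le_self c).trans (Nat.le_add_right c 3), fun ρ d σ _ _ _ _ =>
      ⟨_, Cmd.Runs.set _ _ _ _, ?_, ?_, rfl, rfl, ?_⟩⟩⟩
  · simp [Expr.eval]
  · intro a ha
    exact Mem.update_of_ne _ _ _ ha.ne
  · have := Nat.size_le_self c
    simp [Expr.cost]
    omega

theorem var (i : ℕ) : Feasible (fun _ e => e i) := by
  refine ⟨fun ρ d => .set d (.lit 0) (.reg (ρ i)), fun B => B + 4, by fun_prop, fun I e B h =>
    ⟨(h.2 i).trans (Nat.le_add_right B 4), fun ρ d σ _ _ _ he =>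
      ⟨_, Cmd.Runs.set _ _ _ _, ?_, ?_, rfl, rfl, ?_⟩⟩⟩
  · simp [Expr.eval, he]
  · intro a ha
    exact Mem.update_of_ne _ _ _ ha.ne
  · have := h.2 i
    simp [Expr.cost, Expr.eval, he]
    omega

theorem order : Feasible (fun I _ => I.n) := by
  refine ⟨fun ρ d => .set d (.lit 0) (.reg 0), fun B => B + 4, by fun_prop, fun I e B h =>
    ⟨(Nat.size_le_self _).trans (h.n_le.trans (Nat.le_add_right B 4)), fun ρ d σ _ _ hm he =>
      ⟨_, Cmd.Runs.set _ _ _ _, ?_, ?_, rfl, rfl, ?_⟩⟩⟩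
  · simp [Expr.eval, hm.n_eq]
  · intro a ha
    exact Mem.update_of_ne _ _ _ ha.ne
  · have := (Nat.size_le_self _).trans h.n_le
    simp [Expr.cost, Expr.eval, hm.n_eq]
    omega

theorem input {f : Inst → Env → ℕ} (hf : Feasible f) :
    Feasible (fun I e => inputMem I.G 1 (f I e)) := by
  obtain ⟨cf, tf, pf, hf⟩ := hf
  have h1 : ∀ (I : Inst) i, Nat.size (inputMem I.G 1 i) ≤ 1 := by
    intro I i
    rw [Nat.size_le]
    simp only [inputMem]
    split_ifs <;> simp_all
  refine ⟨fun ρ d => .seq (cf ρ d) (.set d (.lit 0) (.get 1 (.reg d))), fun B => 2 * tf B + 10,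
    by fun_prop, fun I e B h => ⟨(h1 _ _).trans (by beta_reduce; omega), fun ρ d σ hd hρ hm he => ?_⟩⟩
  obtain ⟨hs, hf⟩ := hf I e B h
  obtain ⟨σ₁, r₁, v₁, m₁, b₁, o₁, t₁⟩ := hf ρ d σ hd hρ hm he
  refine ⟨_, .seq r₁ (.set _ _ _ _), ?_, ?_, b₁, o₁, ?_⟩
  · simp [Expr.eval, v₁, (hm.of_eq hd m₁).2]
  · intro a ha
    exact (Mem.update_of_ne _ _ _ ha.ne).trans (m₁ a ha)
  · have := h1 I (f I e)
    simp [Expr.cost, Expr.eval, v₁, (hm.of_eq hd m₁).2]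
    omega

theorem bin (o : Op) {f g : Inst → Env → ℕ} (hf : Feasible f) (hg : Feasible g) :
    Feasible (fun I e => o.eval (f I e) (g I e)) := by
  obtain ⟨cf, tf, pf, hf⟩ := hf
  obtain ⟨cg, tg, pg, hg⟩ := hg
  -- The second operand is computed above `d`, so that the first one survives.
  refine ⟨fun ρ d => .seq (cf ρ d) (.seq (cg ρ (d + 1))
    (.set d (.lit 0) (.bin o (.reg d) (.reg (d + 1))))), fun B => 3 * tf B + 3 * tg B + 10,
    by fun_prop, fun I e B h => ?_⟩
  obtain ⟨sf, hf⟩ := hf I e B h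
  obtain ⟨sg, hg⟩ := hg I e B h
  have ho := Op.size_eval_le o (f I e) (g I e)
  refine ⟨by beta_reduce; omega, fun ρ d σ hd hρ hm he => ?_⟩
  obtain ⟨σ₁, r₁, v₁, m₁, b₁, o₁, t₁⟩ := hf ρ d σ hd hρ hm he
  obtain ⟨σ₂, r₂, v₂, m₂, b₂, o₂, t₂⟩ := hg ρ (d + 1) σ₁ (by omega)
    (fun i => (hρ i).trans (by omega)) (hm.of_eq hd m₁) (fun i => by rw [m₁ _ (hρ i), he])
  have v₁' : σ₂.mem d 0 = f I e := by rw [m₂ d (by omega), v₁]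
  refine ⟨_, .seq r₁ (.seq r₂ (.set _ _ _ _)), ?_, ?_, b₂.trans b₁, o₂.trans o₁, ?_⟩
  · simp [Expr.eval, v₁', v₂]
  · intro a ha
    exact (Mem.update_of_ne _ _ _ ha.ne).trans ((m₂ a (by omega)).trans (m₁ a ha))
  · simp [Expr.cost, Expr.eval, v₁', v₂]
    omega

theorem add {f g : Inst → Env → ℕ} (hf : Feasible f) (hg : Feasible g) :
    Feasible (fun I e => f I e + g I e) := bin .add hf hg

theorem sub {f g : Inst → Env → ℕ} (hf : Feasible f) (hg : Feasible g) :
    Feasible (fun I e => f I e - g I e) := bin .sub hf hg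

theorem mul {f g : Inst → Env → ℕ} (hf : Feasible f) (hg : Feasible g) :
    Feasible (fun I e => f I e * g I e) := bin .mul hf hg

theorem div {f g : Inst → Env → ℕ} (hf : Feasible f) (hg : Feasible g) :
    Feasible (fun I e => f I e / g I e) := bin .div hf hg

theorem mod {f g : Inst → Env → ℕ} (hf : Feasible f) (hg : Feasible g) :
    Feasible (fun I e => f I e % g I e) := bin .mod hf hg

/-- No code is executed for a change of variables: only the arrays from which they are read change.
-/
theorem rename (π : ℕ → ℕ) {f : Inst → Env → ℕ} (hf : Feasible f) :
    Feasible (fun I e => f I (fun i => e (π i))) := by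
  obtain ⟨cf, tf, pf, hf⟩ := hf
  refine ⟨fun ρ d => cf (fun i => ρ (π i)) d, tf, pf, fun I e B h => ?_⟩
  obtain ⟨sf, hf⟩ := hf I (fun i => e (π i)) B ⟨h.1, fun i => h.2 _⟩
  exact ⟨sf, fun ρ d σ hd hρ hm he => hf _ d σ hd (fun i => hρ _) hm (fun i => he _)⟩

/-- The value of `g` stays in array `d`, which becomes the array of the new variable. Its bit length
may reach `tg B`, so the bound for `f` is taken at `B + tg B`. -/
theorem bind {f g : Inst → Env → ℕ} (hg : Feasible g) (hf : Feasible f) :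
    Feasible (fun I e => f I (e.cons (g I e))) := by
  obtain ⟨cf, tf, pf, hf⟩ := hf
  obtain ⟨cg, tg, pg, hg⟩ := hg
  refine ⟨fun ρ d => .seq (cg ρ d) (.seq (cf (Env.cons d ρ) (d + 1))
    (.set d (.lit 0) (.reg (d + 1)))), fun B => 2 * tf (B + tg B) + tg B + 10,
    by fun_prop, fun I e B h => ?_⟩
  obtain ⟨sg, hg⟩ := hg I e B h
  obtain ⟨sf, hf⟩ := hf I (e.cons (g I e)) (B + tg B) ((h.mono (by omega)).cons (by omega))
  refine ⟨by beta_reduce; omega, fun ρ d σ hd hρ hm he => ?_⟩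
  obtain ⟨σ₁, r₁, v₁, m₁, b₁, o₁, t₁⟩ := hg ρ d σ hd hρ hm he
  obtain ⟨σ₂, r₂, v₂, m₂, b₂, o₂, t₂⟩ := hf (Env.cons d ρ) (d + 1) σ₁ (by omega)
    (fun i => by
      cases i with
      | zero => simp
      | succ i => exact (hρ i).trans (by omega))
    (hm.of_eq hd m₁)
    (fun i => by
      cases i with
      | zero => exact v₁
      | succ i => simp [m₁ _ (hρ i), he])
  refine ⟨_, .seq r₁ (.seq r₂ (.set _ _ _ _)), ?_, ?_, b₂.trans b₁, o₂.trans o₁, ?_⟩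
  · simp [Expr.eval, v₂]
  · intro a ha
    exact (Mem.update_of_ne _ _ _ ha.ne).trans ((m₂ a (by omega)).trans (m₁ a ha))
  · simp [Expr.cost, Expr.eval, v₂]
    omega

theorem ite {f g h : Inst → Env → ℕ} (hf : Feasible f) (hg : Feasible g) (hh : Feasible h) :
    Feasible (fun I e => if f I e ≠ 0 then g I e else h I e) := by
  obtain ⟨cf, tf, pf, hf⟩ := hf
  obtain ⟨cg, tg, pg, hg⟩ := hg
  obtain ⟨ch, th, ph, hh⟩ := hh
  refine ⟨fun ρ d => .seq (cf ρ d) (.ite (.reg d) (cg ρ d) (ch ρ d)),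
    fun B => 2 * tf B + tg B + th B + 10, by fun_prop, fun I e B hB => ?_⟩
  obtain ⟨sf, hf⟩ := hf I e B hB
  obtain ⟨sg, hg⟩ := hg I e B hB
  obtain ⟨sh, hh⟩ := hh I e B hB
  refine ⟨by beta_reduce; split_ifs <;> omega, fun ρ d σ hd hρ hm he => ?_⟩
  obtain ⟨σ₁, r₁, v₁, m₁, b₁, o₁, t₁⟩ := hf ρ d σ hd hρ hm he
  have hev : (Expr.reg d).eval σ₁.mem = f I e := by simp [Expr.eval, v₁]
  have hc : (Expr.reg d).cost σ₁.mem ≤ 2 + tf B := by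
    simp [Expr.cost, Expr.eval, v₁]
    omega
  beta_reduce
  split_ifs with h0
  · obtain ⟨σ₂, r₂, v₂, m₂, b₂, o₂, t₂⟩ := hg ρ d (σ₁.tick (1 + (Expr.reg d).cost σ₁.mem)) hd hρ
      (hm.of_eq hd m₁) (fun i => by simp [m₁ _ (hρ i), he])
    refine ⟨σ₂, .seq r₁ (.ite_true (by rwa [hev]) r₂), v₂, fun a ha => (m₂ a ha).trans (m₁ a ha),
      b₂.trans b₁, o₂.trans o₁, ?_⟩
    simp at t₂
    omega
  · obtain ⟨σ₂, r₂, v₂, m₂, b₂, o₂, t₂⟩ := hh ρ d (σ₁.tick (1 + (Expr.reg d).cost σ₁.mem)) hd hρ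
      (hm.of_eq hd m₁) (fun i => by simp [m₁ _ (hρ i), he])
    refine ⟨σ₂, .seq r₁ (.ite_false (by rw [hev]; omega) r₂), v₂,
      fun a ha => (m₂ a ha).trans (m₁ a ha), b₂.trans b₁, o₂.trans o₁, ?_⟩
    simp at t₂
    omega

/-- Primitive recursion of length `lim` on an accumulator (variable `0` of the step function; variable
`1` counts the steps). -/
def iterate (init : Inst → Env → ℕ) (step : Inst → Env → ℕ) (I : Inst) (e : Env) : ℕ → ℕ
  | 0 => init I e
  | j + 1 => step I ((e.cons j).cons (iterate init step I e j))

/-- The number of rounds must be small in value, not only in bit length. The accumulator needs its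
own bound `s`, because a polynomial increase of the bit length in each round could compound to
exponential length. -/
theorem iter {lim init step : Inst → Env → ℕ} (hlim : Feasible lim) (hinit : Feasible init)
    (hstep : Feasible step) (hl : Small lim) {s : ℕ → ℕ} (hs : PolyBounded s)
    (hacc : ∀ I e B, Fits I e B → ∀ j ≤ lim I e, Nat.size (iterate init step I e j) ≤ s B) :
    Feasible (fun I e => iterate init step I e (lim I e)) := by
  obtain ⟨cl, tl, pl, hlim⟩ := hlim
  obtain ⟨ci, ti, pi, hinit⟩ := hinit
  obtain ⟨cs, ts, ps, hstep⟩ := hstep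
  obtain ⟨l, pl', hl⟩ := hl
  -- Arrays `d`, `d + 1`, `d + 2` hold the limit, the accumulator and the counter, and `d + 3`
  -- receives the result of a step. The truncated difference of limit and counter is the loop test.
  refine ⟨fun ρ d => .seq (cl ρ d) (.seq (ci ρ (d + 1)) (.seq (.set (d + 2) (.lit 0) (.lit 0))
    (.seq (.loop (.bin .sub (.reg d) (.reg (d + 2)))
      (.seq (cs (Env.cons (d + 1) (Env.cons (d + 2) ρ)) (d + 3))
        (.seq (.set (d + 1) (.lit 0) (.reg (d + 3)))
          (.set (d + 2) (.lit 0) (.bin .add (.reg (d + 2)) (.lit 1))))))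
      (.set d (.lit 0) (.reg (d + 1)))))),
    fun B => tl B + ti B + (l B + 1) * (ts (B + l B + s B) + 10 * l B + s B + 30) + s B + 30,
    by fun_prop, fun I e B h => ?_⟩
  beta_reduce
  obtain ⟨sl, hlim⟩ := hlim I e B h
  obtain ⟨si, hinit⟩ := hinit I e B h
  replace hl := hl I e B h
  replace hacc := hacc I e B h
  generalize hA : iterate init step I e = A at *
  have hA0 : A 0 = init I e := by rw [← hA]; rfl
  have hA1 : ∀ j, A (j + 1) = step I ((e.cons j).cons (A j)) := by
    intro j; rw [← hA]; rfl
  generalize lim I e = N at *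
  have hT : (N + 1) * (ts (B + l B + s B) + 10 * l B + s B + 30) ≤
      (l B + 1) * (ts (B + l B + s B) + 10 * l B + s B + 30) := Nat.mul_le_mul_right _ (by omega)
  generalize hW : ts (B + l B + s B) + 10 * l B + s B + 30 = W at *
  refine ⟨by have := hacc N le_rfl; omega, fun ρ d σ hd hρ hm he => ?_⟩
  -- Induction on the number `r` of remaining rounds; each round, and the final failing test, is
  -- paid for by one `W`.
  have key : ∀ r j, j + r = N → ∀ σ₀ : State, σ₀.mem d 0 = N → σ₀.mem (d + 1) 0 = A j →
      σ₀.mem (d + 2) 0 = j → (∀ a < d, σ₀.mem a = σ.mem a) →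
      ∃ σ', Cmd.Runs (.loop (.bin .sub (.reg d) (.reg (d + 2)))
      (.seq (cs (Env.cons (d + 1) (Env.cons (d + 2) ρ)) (d + 3))
        (.seq (.set (d + 1) (.lit 0) (.reg (d + 3)))
          (.set (d + 2) (.lit 0) (.bin .add (.reg (d + 2)) (.lit 1)))))) σ₀ σ' ∧
        σ'.mem (d + 1) 0 = A N ∧ (∀ a < d, σ'.mem a = σ.mem a) ∧ σ'.buf = σ₀.buf ∧
        σ'.out = σ₀.out ∧ σ'.time ≤ σ₀.time + (r + 1) * W := by
    intro r
    induction r with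
    | zero =>
      intro j hj σ₀ h0 h1 h2 h3
      obtain rfl : j = N := by omega
      refine ⟨_, .loop_done (by simp [Expr.eval, Op.eval, h0, h2]), by simpa using h1,
        by simpa using h3, rfl, rfl, ?_⟩
      have := Nat.size_le_self j
      simp [Expr.cost, Expr.eval, h0, h2, Op.eval]
      omega
    | succ r ih =>
      intro j hj σ₀ h0 h1 h2 h3
      have hjN : Nat.size j ≤ j := Nat.size_le_self j
      have hNN : Nat.size N ≤ N := Nat.size_le_self N
      have hj1 : Nat.size (j + 1) ≤ j + 1 := Nat.size_le_self _
      have hNj : Nat.size (N - j) ≤ N := (Nat.size_le_self _).trans (by omega)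
      have haj := hacc j (by omega)
      have haj1 := hacc (j + 1) (by omega)
      obtain ⟨ss, hstep⟩ := hstep I ((e.cons j).cons (A j)) (B + l B + s B)
        (((h.mono (by omega)).cons (by omega)).cons (by omega))
      set c := Expr.cost σ₀.mem (.bin .sub (.reg d) (.reg (d + 2))) with hc
      have hc' : c ≤ 3 * l B + 5 := by
        rw [hc]
        simp [Expr.cost, Expr.eval, h0, h2, Op.eval]
        omega
      obtain ⟨σ₁, r₁, v₁, m₁, b₁, o₁, t₁⟩ := hstep (Env.cons (d + 1) (Env.cons (d + 2) ρ)) (d + 3)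
        (σ₀.tick (1 + c)) (by omega)
        (fun i => by
          match i with
          | 0 => simp
          | 1 => simp
          | i + 2 => simpa using (hρ i).trans (by omega))
        (hm.of_eq hd h3)
        (fun i => by
          match i with
          | 0 => simpa using h1
          | 1 => simpa using h2
          | i + 2 => simp [h3 _ (hρ i), he])
      have v₁' : σ₁.mem (d + 3) 0 = A (j + 1) := by rw [v₁, hA1]
      set σ₂ := σ₁.assign (d + 1) (A (j + 1)) (4 + Nat.size (A (j + 1))) with hσ₂
      have m₂ : σ₂.mem (d + 2) 0 = j := by
        rw [hσ₂, State.assign_mem, Mem.update_of_ne _ _ _ (by omega), m₁ _ (by omega)]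
        exact h2
      set σ₃ := σ₂.assign (d + 2) (j + 1) (7 + Nat.size j + Nat.size (j + 1)) with hσ₃
      have r₂ : Cmd.Runs (.set (d + 1) (.lit 0) (.reg (d + 3))) σ₁ σ₂ :=
        .assign _ (Expr.eval_reg v₁') (by rw [Expr.cost_reg v₁']; omega)
      have r₃ : Cmd.Runs (.set (d + 2) (.lit 0) (.bin .add (.reg (d + 2)) (.lit 1))) σ₂ σ₃ := by
        refine .assign _ (by simp [Expr.eval, Op.eval, m₂]) ?_
        simp [Expr.cost, Expr.eval, Op.eval, m₂]
        omega
      obtain ⟨σ', r', v', m', b', o', t'⟩ := ih (j + 1) (by omega) σ₃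
        (by
          rw [hσ₃, State.assign_mem, Mem.update_of_ne _ _ _ (by omega), hσ₂, State.assign_mem,
            Mem.update_of_ne _ _ _ (by omega), m₁ _ (by omega)]
          exact h0)
        (by
          rw [hσ₃, State.assign_mem, Mem.update_of_ne _ _ _ (by omega), hσ₂, State.assign_mem,
            Mem.update_self])
        (by rw [hσ₃, State.assign_mem, Mem.update_self])
        (by
          intro a ha
          rw [hσ₃, State.assign_mem, Mem.update_of_ne _ _ _ (by omega), hσ₂, State.assign_mem,
            Mem.update_of_ne _ _ _ (by omega), m₁ _ (by omega)]
          exact h3 a ha)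
      refine ⟨σ', .loop_step (by simp [Expr.eval, Op.eval, h0, h2]; omega)
        (.seq r₁ (.seq r₂ r₃)) r', v', m', b'.trans b₁, o'.trans o₁, t'.trans ?_⟩
      rw [hσ₃, State.assign_time, hσ₂, State.assign_time]
      have : (r + 1 + 1) * W = (r + 1) * W + W := by ring
      rw [State.tick_time] at t₁
      omega
  obtain ⟨σ₁, r₁, v₁, m₁, b₁, o₁, t₁⟩ := hlim ρ d σ hd hρ hm he
  obtain ⟨σ₂, r₂, v₂, m₂, b₂, o₂, t₂⟩ := hinit ρ (d + 1) σ₁ (by omega)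
    (fun i => (hρ i).trans (by omega)) (hm.of_eq hd m₁) (fun i => by rw [m₁ _ (hρ i), he])
  obtain ⟨σ₃, r₃, v₃, m₃, b₃, o₃, t₃⟩ := key N 0 (by omega) (σ₂.assign (d + 2) 0 3)
    (by rw [State.assign_mem, Mem.update_of_ne _ _ _ (by omega), m₂ d (by omega), v₁])
    (by rw [State.assign_mem, Mem.update_of_ne _ _ _ (by omega), v₂, hA0])
    (by simp)
    (by
      intro a ha
      exact (Mem.update_of_ne _ _ _ (by omega)).trans ((m₂ a (by omega)).trans (m₁ a ha)))
  refine ⟨_, .seq r₁ (.seq r₂ (.seq (.assign _ rfl rfl) (.seq r₃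
    (.assign _ (Expr.eval_reg v₃) (by rw [Expr.cost_reg v₃])))) ), by simp, ?_,
    b₃.trans (b₂.trans b₁), o₃.trans (o₂.trans o₁), ?_⟩
  · intro a ha
    exact (Mem.update_of_ne _ _ _ ha.ne).trans (m₃ a ha)
  · have := hacc N le_rfl
    rw [State.assign_time] at t₃ ⊢
    omega

end Feasible

/-! ### Bounded sums and products, decidable predicates and bounded quantifiers -/

/-- The truth value of a proposition as a number. -/
noncomputable def ind (p : Prop) : ℕ := open Classical in if p then 1 else 0

@[simp] theorem ind_eq_zero {p : Prop} : ind p = 0 ↔ ¬p := by simp [ind]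

theorem ind_of {p : Prop} (h : p) : ind p = 1 := by simp [ind, h]
theorem ind_of_not {p : Prop} (h : ¬p) : ind p = 0 := by simp [ind, h]

/-- The predicate `p` is decided in polynomial time. -/
def Decides (p : Inst → Env → Prop) : Prop := Feasible (fun I e => ind (p I e))

namespace Small

theorem order : Small (fun I _ => I.n) := ⟨fun B => B, by fun_prop, fun _ _ _ h => h.n_le⟩

theorem add {f g : Inst → Env → ℕ} (hf : Small f) (hg : Small g) :
    Small (fun I e => f I e + g I e) := by
  obtain ⟨s, ps, hs⟩ := hf
  obtain ⟨t, pt, ht⟩ := hg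
  exact ⟨fun B => s B + t B, by fun_prop, fun I e B h => Nat.add_le_add (hs I e B h) (ht I e B h)⟩

theorem mul {f g : Inst → Env → ℕ} (hf : Small f) (hg : Small g) :
    Small (fun I e => f I e * g I e) := by
  obtain ⟨s, ps, hs⟩ := hf
  obtain ⟨t, pt, ht⟩ := hg
  exact ⟨fun B => s B * t B, by fun_prop, fun I e B h => Nat.mul_le_mul (hs I e B h) (ht I e B h)⟩

theorem mono {f g : Inst → Env → ℕ} (hg : Small g) (h : ∀ I e, f I e ≤ g I e) : Small f := by
  obtain ⟨t, pt, ht⟩ := hg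
  exact ⟨t, pt, fun I e B hB => (h I e).trans (ht I e B hB)⟩

end Small

namespace Feasible

theorem congr {f g : Inst → Env → ℕ} (hf : Feasible f) (h : ∀ I e, f I e = g I e) : Feasible g := by
  obtain rfl : f = g := by funext I e; exact h I e
  exact hf

/-- At most `l` terms below `2 ^ t` have partial sums with at most `l + t` bits, which is the bound
that the recursion needs. -/
theorem sum {lim : Inst → Env → ℕ} {g : Inst → Env → ℕ → ℕ} (hlim : Feasible lim) (hl : Small lim)
    (hg : Feasible (fun I e => g I (fun i => e (i + 1)) (e 0))) :
    Feasible (fun I e => ∑ j ∈ Finset.range (lim I e), g I e j) := by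
  have hit : ∀ I e j, iterate (fun _ _ => 0)
      (fun I e => e 0 + g I (fun i => e (i + 2)) (e 1)) I e j = ∑ i ∈ Finset.range j, g I e i := by
    intro I e j
    induction j with
    | zero => rfl
    | succ j ih => rw [iterate, Finset.sum_range_succ, Env.cons_zero, ih]; rfl
  obtain ⟨l, pl, hl'⟩ := id hl
  obtain ⟨_, t, pt, ht⟩ := id hg
  refine (iter (init := fun _ _ => 0) hlim (const 0) ((var 0).add (hg.rename Nat.succ)) hl
    (s := fun B => l B + t (B + l B)) (by fun_prop) ?_).congr fun I e => hit I e _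
  intro I e B h j hj
  rw [hit, Nat.size_le]
  have hl' := hl' I e B h
  have h1 : ∀ i ∈ Finset.range j, g I e i ≤ 2 ^ t (B + l B) := by
    intro i hi
    have hi : i < j := by simpa using hi
    have := Nat.size_le_self i
    exact (Nat.size_le.1 (ht I (e.cons i) (B + l B)
      ((h.mono (by omega)).cons (by omega))).1).le
  refine (Finset.sum_le_card_nsmul _ _ _ h1).trans_lt ?_
  rw [Finset.card_range, smul_eq_mul, pow_add]
  refine Nat.mul_lt_mul_of_pos_right ?_ (by positivity)
  exact (hj.trans hl').trans_lt Nat.lt_two_pow_self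

/-- Bit lengths add up in a product, so `l` factors multiply them by at most `l`; this stays
polynomial because `lim` is small. -/
theorem prod {lim : Inst → Env → ℕ} {g : Inst → Env → ℕ → ℕ} (hlim : Feasible lim) (hl : Small lim)
    (hg : Feasible (fun I e => g I (fun i => e (i + 1)) (e 0))) :
    Feasible (fun I e => ∏ j ∈ Finset.range (lim I e), g I e j) := by
  have hit : ∀ I e j, iterate (fun _ _ => 1)
      (fun I e => e 0 * g I (fun i => e (i + 2)) (e 1)) I e j = ∏ i ∈ Finset.range j, g I e i := by
    intro I e j
    induction j with
    | zero => rfl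
    | succ j ih => rw [iterate, Finset.prod_range_succ, Env.cons_zero, ih]; rfl
  obtain ⟨l, pl, hl'⟩ := id hl
  obtain ⟨_, t, pt, ht⟩ := id hg
  refine (iter (init := fun _ _ => 1) hlim (const 1) ((var 0).mul (hg.rename Nat.succ)) hl
    (s := fun B => t (B + l B) * l B + 1) (by fun_prop) ?_).congr fun I e => hit I e _
  intro I e B h j hj
  rw [hit, Nat.size_le]
  have hl' := hl' I e B h
  have h1 : ∀ i ∈ Finset.range j, g I e i ≤ 2 ^ t (B + l B) := by
    intro i hi
    have hi : i < j := by simpa using hi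
    have := Nat.size_le_self i
    exact (Nat.size_le.1 (ht I (e.cons i) (B + l B)
      ((h.mono (by omega)).cons (by omega))).1).le
  refine (Finset.prod_le_pow_card _ _ _ h1).trans_lt ?_
  rw [Finset.card_range, ← pow_mul]
  exact Nat.pow_lt_pow_right (by omega)
    (Nat.lt_succ_of_le (Nat.mul_le_mul_left _ (hj.trans hl')))

theorem pow {f g : Inst → Env → ℕ} (hf : Feasible f) (hg : Feasible g) (hs : Small g) :
    Feasible (fun I e => f I e ^ g I e) :=
  (prod (g := fun I e _ => f I e) hg hs (hf.rename Nat.succ)).congr fun I e => by simp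

theorem min {f g : Inst → Env → ℕ} (hf : Feasible f) (hg : Feasible g) :
    Feasible (fun I e => Min.min (f I e) (g I e)) :=
  (hf.sub (hf.sub hg)).congr fun I e => by omega

theorem max {f g : Inst → Env → ℕ} (hf : Feasible f) (hg : Feasible g) :
    Feasible (fun I e => Max.max (f I e) (g I e)) :=
  (hf.add (hg.sub hf)).congr fun I e => by omega

theorem cond {p : Inst → Env → Prop} [∀ I e, Decidable (p I e)] {f g : Inst → Env → ℕ}
    (hp : Decides p) (hf : Feasible f) (hg : Feasible g) :
    Feasible (fun I e => if p I e then f I e else g I e) :=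
  (ite hp hf hg).congr fun I e => by simp

end Feasible

namespace Decides

theorem congr {p q : Inst → Env → Prop} (hp : Decides p) (h : ∀ I e, p I e ↔ q I e) :
    Decides q := by
  obtain rfl : p = q := by funext I e; exact propext (h I e)
  exact hp

theorem ne_zero {f : Inst → Env → ℕ} (hf : Feasible f) : Decides (fun I e => f I e ≠ 0) :=
  (Feasible.ite hf (.const 1) (.const 0)).congr fun I e => by simp [ind]

theorem not {p : Inst → Env → Prop} (hp : Decides p) : Decides (fun I e => ¬p I e) :=
  (Feasible.sub (.const 1) hp).congr fun I e => by by_cases h : p I e <;> simp [ind, h]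

theorem and {p q : Inst → Env → Prop} (hp : Decides p) (hq : Decides q) :
    Decides (fun I e => p I e ∧ q I e) :=
  (Feasible.mul hp hq).congr fun I e => by
    by_cases h : p I e <;> by_cases h' : q I e <;> simp [ind, h, h']

theorem or {p q : Inst → Env → Prop} (hp : Decides p) (hq : Decides q) :
    Decides (fun I e => p I e ∨ q I e) :=
  (hp.not.and hq.not).not.congr fun I e => by tauto

theorem imp {p q : Inst → Env → Prop} (hp : Decides p) (hq : Decides q) :
    Decides (fun I e => p I e → q I e) :=
  (hp.not.or hq).congr fun I e => by tauto

theorem iff {p q : Inst → Env → Prop} (hp : Decides p) (hq : Decides q) :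
    Decides (fun I e => p I e ↔ q I e) :=
  ((hp.imp hq).and (hq.imp hp)).congr fun I e => by tauto

theorem lt {f g : Inst → Env → ℕ} (hf : Feasible f) (hg : Feasible g) :
    Decides (fun I e => f I e < g I e) :=
  (ne_zero (hg.sub hf)).congr fun I e => by omega

theorem le {f g : Inst → Env → ℕ} (hf : Feasible f) (hg : Feasible g) :
    Decides (fun I e => f I e ≤ g I e) :=
  (lt hg hf).not.congr fun I e => by omega

theorem eq {f g : Inst → Env → ℕ} (hf : Feasible f) (hg : Feasible g) :
    Decides (fun I e => f I e = g I e) :=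
  ((le hf hg).and (le hg hf)).congr fun I e => by omega

/-- The search is a sum of truth values that is tested for being nonzero. -/
theorem exists_lt {lim : Inst → Env → ℕ} {p : Inst → Env → ℕ → Prop} (hlim : Feasible lim)
    (hl : Small lim) (hp : Decides (fun I e => p I (fun i => e (i + 1)) (e 0))) :
    Decides (fun I e => ∃ j < lim I e, p I e j) :=
  (ne_zero (Feasible.sum (g := fun I e j => ind (p I e j)) hlim hl hp)).congr fun I e => by
    simp [Finset.sum_eq_zero_iff]

theorem forall_lt {lim : Inst → Env → ℕ} {p : Inst → Env → ℕ → Prop} (hlim : Feasible lim)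
    (hl : Small lim) (hp : Decides (fun I e => p I (fun i => e (i + 1)) (e 0))) :
    Decides (fun I e => ∀ j < lim I e, p I e j) :=
  (exists_lt (p := fun I e j => ¬p I e j) hlim hl hp.not).not.congr fun I e => by
    push Not
    rfl

end Decides

/-! ### Functions of a fixed number of variables -/

def Feasible₀ (f : Inst → ℕ) : Prop := Feasible (fun I _ => f I)
def Feasible₁ (f : Inst → ℕ → ℕ) : Prop := Feasible (fun I e => f I (e 0))
def Feasible₂ (f : Inst → ℕ → ℕ → ℕ) : Prop := Feasible (fun I e => f I (e 0) (e 1))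
def Feasible₃ (f : Inst → ℕ → ℕ → ℕ → ℕ) : Prop := Feasible (fun I e => f I (e 0) (e 1) (e 2))

def Decides₀ (p : Inst → Prop) : Prop := Decides (fun I _ => p I)
def Decides₁ (p : Inst → ℕ → Prop) : Prop := Decides (fun I e => p I (e 0))
def Decides₂ (p : Inst → ℕ → ℕ → Prop) : Prop := Decides (fun I e => p I (e 0) (e 1))
def Decides₃ (p : Inst → ℕ → ℕ → ℕ → Prop) : Prop := Decides (fun I e => p I (e 0) (e 1) (e 2))

theorem Feasible₁.comp {f : Inst → ℕ → ℕ} (hf : Feasible₁ f) {a : Inst → Env → ℕ}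
    (ha : Feasible a) : Feasible (fun I e => f I (a I e)) :=
  Feasible.bind ha hf

/-- The last argument is bound first, so that the first one ends up as variable `0`; the renaming
undoes the shift caused by the earlier binding. -/
theorem Feasible₂.comp {f : Inst → ℕ → ℕ → ℕ} (hf : Feasible₂ f) {a b : Inst → Env → ℕ}
    (ha : Feasible a) (hb : Feasible b) : Feasible (fun I e => f I (a I e) (b I e)) :=
  Feasible.bind hb (Feasible.bind (ha.rename Nat.succ) hf)

theorem Feasible₃.comp {f : Inst → ℕ → ℕ → ℕ → ℕ} (hf : Feasible₃ f) {a b c : Inst → Env → ℕ}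
    (ha : Feasible a) (hb : Feasible b) (hc : Feasible c) :
    Feasible (fun I e => f I (a I e) (b I e) (c I e)) :=
  Feasible.bind hc (Feasible.bind (hb.rename Nat.succ)
    (Feasible.bind (ha.rename (fun i => i + 2)) hf))

theorem Decides₁.comp {p : Inst → ℕ → Prop} (hp : Decides₁ p) {a : Inst → Env → ℕ}
    (ha : Feasible a) : Decides (fun I e => p I (a I e)) :=
  Feasible₁.comp (f := fun I x => ind (p I x)) hp ha

theorem Decides₂.comp {p : Inst → ℕ → ℕ → Prop} (hp : Decides₂ p) {a b : Inst → Env → ℕ}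
    (ha : Feasible a) (hb : Feasible b) : Decides (fun I e => p I (a I e) (b I e)) :=
  Feasible₂.comp (f := fun I x y => ind (p I x y)) hp ha hb

theorem Decides₃.comp {p : Inst → ℕ → ℕ → ℕ → Prop} (hp : Decides₃ p) {a b c : Inst → Env → ℕ}
    (ha : Feasible a) (hb : Feasible b) (hc : Feasible c) :
    Decides (fun I e => p I (a I e) (b I e) (c I e)) :=
  Feasible₃.comp (f := fun I x y z => ind (p I x y z)) hp ha hb hc

/-! ## Counting loops -/

/-- `for i < l do c`, for scalars `i` and `l`. -/
def Cmd.count (i l : ℕ) (c : Cmd) : Cmd :=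
  .seq (.set i (.lit 0) (.lit 0)) (.loop (.bin .sub (.reg l) (.reg i))
    (.seq c (.set i (.lit 0) (.bin .add (.reg i) (.lit 1)))))

/-- A bound for the cost of the control of one iteration of a loop of length `N`. -/
def overhead (N : ℕ) : ℕ := 20 + 6 * Nat.size N

/-- `Q` is an invariant of the number of rounds, the buffer, the output and the clock. Asking for it
at all clock offsets up to `overhead N` hides the exact cost of the loop control. The overhead
involves only the bit length of `N`, so loops of exponential length are covered. -/
theorem Cmd.count_runs {i l N : ℕ} {c : Cmd} {σ : State} (hli : l < i) (hl : σ.mem l 0 = N)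
    (Q : ℕ → List ℕ → List (ℕ × List ℕ) → ℕ → Prop)
    (h0 : ∀ t ≤ overhead N, Q 0 σ.buf σ.out (σ.time + t))
    (step : ∀ j < N, ∀ σ₁ : State, (∀ b < i, σ₁.mem b = σ.mem b) → σ₁.mem i 0 = j →
      Q j σ₁.buf σ₁.out σ₁.time → ∃ σ₂, c.Runs σ₁ σ₂ ∧ (∀ b < i + 1, σ₂.mem b = σ₁.mem b) ∧
        ∀ t ≤ overhead N, Q (j + 1) σ₂.buf σ₂.out (σ₂.time + t)) :
    ∃ σ', (Cmd.count i l c).Runs σ σ' ∧ (∀ b < i, σ'.mem b = σ.mem b) ∧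
      Q N σ'.buf σ'.out σ'.time := by
  -- The amount `8 + 2 * Nat.size N` of the overhead is held back for setting or incrementing the
  -- counter; the rest covers the loop test.
  have key : ∀ r j, j + r = N → ∀ σ₁ : State, (∀ b < i, σ₁.mem b = σ.mem b) → σ₁.mem i 0 = j →
      (∀ t ≤ overhead N - (8 + 2 * Nat.size N), Q j σ₁.buf σ₁.out (σ₁.time + t)) →
      ∃ σ', Cmd.Runs (.loop (.bin .sub (.reg l) (.reg i))
        (.seq c (.set i (.lit 0) (.bin .add (.reg i) (.lit 1))))) σ₁ σ' ∧
        (∀ b < i, σ'.mem b = σ.mem b) ∧ Q N σ'.buf σ'.out σ'.time := by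
    intro r
    induction r with
    | zero =>
      intro j hj σ₁ hm hi hQ
      obtain rfl : j = N := by omega
      have hl' : σ₁.mem l 0 = j := by rw [hm l hli, hl]
      refine ⟨_, .loop_done (by simp [Expr.eval, Op.eval, hi, hl']), hm, hQ _ ?_⟩
      simp [Expr.cost, Expr.eval, Op.eval, hi, hl', overhead]
      omega
    | succ r ih =>
      intro j hj σ₁ hm hi hQ
      have hl' : σ₁.mem l 0 = N := by rw [hm l hli, hl]
      have s1 : Nat.size j ≤ Nat.size N := Nat.size_le_size (by omega)
      have s2 : Nat.size (j + 1) ≤ Nat.size N := Nat.size_le_size (by omega)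
      have s3 : Nat.size (N - j) ≤ Nat.size N := Nat.size_le_size (by omega)
      obtain ⟨σ₂, r₂, m₂, q₂⟩ := step j (by omega)
        (σ₁.tick (1 + Expr.cost σ₁.mem (.bin .sub (.reg l) (.reg i)))) hm hi (by
          refine hQ _ ?_
          simp [Expr.cost, Expr.eval, Op.eval, hi, hl', overhead]
          omega)
      have hi₂ : σ₂.mem i 0 = j := by rw [m₂ i (by omega)]; exact hi
      obtain ⟨σ', r', m', q'⟩ := ih (j + 1) (by omega)
        (σ₂.assign i (j + 1) (7 + Nat.size j + Nat.size (j + 1)))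
        (fun b hb => (Mem.update_of_ne _ _ _ hb.ne).trans ((m₂ b (by omega)).trans (hm b hb)))
        (by simp) (by
          intro t ht
          rw [State.assign_time, add_assoc σ₂.time]
          refine q₂ _ ?_
          simp only [overhead] at ht ⊢
          omega)
      refine ⟨σ', .loop_step (by simp [Expr.eval, Op.eval, hi, hl']; omega) (.seq r₂
        (.assign _ (by simp [Expr.eval, Op.eval, hi₂]) ?_)) r', m', q'⟩
      simp [Expr.cost, Expr.eval, Op.eval, hi₂]
      omega
  obtain ⟨σ', r', m', q'⟩ := key N 0 (by omega) (σ.assign i 0 3)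
    (fun b hb => Mem.update_of_ne _ _ _ hb.ne) (by simp) (by
      intro t ht
      rw [State.assign_time, add_assoc]
      refine h0 _ ?_
      simp only [overhead] at ht ⊢
      omega)
  exact ⟨σ', .seq (.assign _ rfl rfl) r', m', q'⟩

/-! ## Delay -/

/-- The delays of the outputs so far are at most `D`, and at most `s` units of time have passed since
the last output. -/
def Delays (D s : ℕ) (out : List (ℕ × List ℕ)) (t : ℕ) : Prop :=
  List.IsChain (fun a b => b ≤ a + D) (0 :: out.map Prod.fst) ∧
    ∀ a ∈ (0 :: out.map Prod.fst).getLast?, t ≤ a + s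

theorem Delays.mono {D s s' t t' r : ℕ} {out : List (ℕ × List ℕ)} (h : Delays D s out t)
    (ht : t' ≤ t + r) (hs : s + r ≤ s') : Delays D s' out t' :=
  ⟨h.1, fun a ha => by have := h.2 a ha; omega⟩

theorem Delays.chain {D s t : ℕ} {out : List (ℕ × List ℕ)} (h : Delays D s out t) (hs : s ≤ D) :
    List.IsChain (fun a b => b ≤ a + D) (0 :: (out.map Prod.fst ++ [t])) := by
  rw [← List.cons_append, List.isChain_append]
  refine ⟨h.1, by simp, fun a ha b hb => ?_⟩
  have := h.2 a ha
  simp at hb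
  omega

theorem Delays.emit {D s t : ℕ} {out : List (ℕ × List ℕ)} (h : Delays D s out t) (hs : s ≤ D)
    (w : List ℕ) : Delays D 0 (out ++ [(t, w)]) t := by
  refine ⟨by simpa using h.chain hs, fun a ha => ?_⟩
  rw [List.map_append, ← List.cons_append, List.getLast?_append] at ha
  simp at ha
  omega

/-! ## The enumeration scheme -/

section Scheme

variable (K : Inst → ℕ) (T : Inst → ℕ → Prop) (N : Inst → ℕ → ℕ)
  (R : Inst → ℕ → ℕ → ℕ → ℕ → Prop)

open Classical in
/-- The row `u` of the list of pairs that is output for the indices `k` and `q`. -/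
noncomputable def rowWord (I : Inst) (k q u : ℕ) (m : ℕ) : List ℕ :=
  (List.range m).flatMap fun v => if R I k q u v then [u, v] else []

/-- The list of pairs that is output for the indices `k` and `q`. -/
noncomputable def relWord (I : Inst) (k q : ℕ) (m : ℕ) : List ℕ :=
  (List.range m).flatMap fun u => rowWord R I k q u I.n

open Classical in
/-- The list of pairs of indices for which there is an output. -/
noncomputable def indexList (I : Inst) (m : ℕ) : List (ℕ × ℕ) :=
  (List.range m).flatMap fun k => if T I k then (List.range (N I k)).map (Prod.mk k) else []

/-- The registers of the variables `k`, `q`, `u`, `v`; the other variables are zero. -/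
def regs : ℕ → ℕ
  | 0 => 4
  | 1 => 6
  | 2 => 7
  | 3 => 8
  | _ => 2

/-- The registers of `k`; the other variables are zero. -/
def regsK : ℕ → ℕ
  | 0 => 4
  | _ => 2

/-- The values of `k`, `q`, `u`, `v`. -/
def envOf (k q u v : ℕ) : Env
  | 0 => k
  | 1 => q
  | 2 => u
  | 3 => v
  | _ => 0

/-- Only `K` has to be small: every `q` below `N I k` produces an output, so `N` may be exponential
without affecting the delay. Silent time accumulates only over values of `k` without output, at most
`S` for each, plus the preparation. -/
theorem exists_scheme (hK : Feasible₀ K) (hKs : Small fun I _ => K I) (hT : Decides₁ T)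
    (hN : Feasible₁ N) (hR : Decides fun I e => R I (e 0) (e 1) (e 2) (e 3)) :
    ∃ (P : Cmd) (D : ℕ → ℕ), PolyBounded D ∧ ∀ I : Inst, ∃ σ, P.Runs (initState I.G) σ ∧
      σ.out.map Prod.snd =
        (indexList T N I (K I)).map (fun p => relWord R I p.1 p.2 I.n) ∧
      List.IsChain (fun s t => t ≤ s + D I.scale) (0 :: (σ.out.map Prod.fst ++ [σ.time])) := by
  obtain ⟨κ, pκ, hκ⟩ := hKs
  obtain ⟨cK, tK, pK, hK⟩ := hK
  obtain ⟨cT, tT, pT, hT⟩ := hT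
  obtain ⟨cN, tN, pN, hN⟩ := hN
  obtain ⟨cR, tR, pR, hR⟩ := hR
  -- bounds for the sizes of the variables
  let B₁ : ℕ → ℕ := fun B => B + κ B
  let B₂ : ℕ → ℕ := fun B => B₁ B + tN (B₁ B)
  -- bounds for the cost of one iteration
  let Wv : ℕ → ℕ := fun B => tR (B₂ B) + 8 * B + 60
  let Wu : ℕ → ℕ := fun B => (B + 1) * Wv B + 6 * B + 30
  let Wq : ℕ → ℕ := fun B => (B + 1) * Wu B + 6 * B + 30
  let S : ℕ → ℕ := fun B => Wq B + tK B + tT (B₁ B) + 10 * tN (B₁ B) + 10 * κ B + 100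
  let D : ℕ → ℕ := fun B => (κ B + 3) * S B
  have pWv : PolyBounded Wv := by fun_prop
  have pD : PolyBounded D := by fun_prop
  -- Arrays 3 and 5 hold the limits for `k` and `q`, array 2 stays zero, and everything from 9 on is
  -- scratch space.
  let body : Cmd := .seq (cR regs 9) (.ite (.reg 9) (.seq (.write (.reg 7)) (.write (.reg 8))) .skip)
  let solution : Cmd := .seq (.count 7 0 (.count 8 0 body)) .emit
  let trial : Cmd := .seq (cT regsK 9) (.ite (.reg 9) (.seq (cN regsK 9)
    (.seq (.set 5 (.lit 0) (.reg 9)) (.count 6 5 solution))) .skip)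
  refine ⟨.seq (cK (fun _ => 2) 9) (.seq (.set 3 (.lit 0) (.reg 9)) (.count 4 3 trial)), D, pD,
    fun I => ?_⟩
  set B := I.scale with hB
  have hfit : Fits I (fun _ => 0) B := ⟨le_rfl, fun _ => by simp⟩
  have hn : I.n ≤ B := hfit.n_le
  have hns : Nat.size I.n ≤ B := (Nat.size_le_self _).trans hn
  have hκK : K I ≤ κ B := hκ I _ B hfit
  have hon : overhead I.n ≤ 6 * B + 20 := by simp only [overhead]; omega
  have hinit : Holds I (inputMem I.G) := ⟨rfl, rfl⟩
  have hzero : inputMem I.G 2 0 = 0 := by simp [inputMem]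
  -- one pair
  have hbody : ∀ k q u v, k < K I → Nat.size q ≤ tN (B₁ B) → u < I.n → v < I.n → ∀ σ : State,
      Holds I σ.mem → σ.mem 2 0 = 0 → σ.mem 4 0 = k → σ.mem 6 0 = q → σ.mem 7 0 = u →
      σ.mem 8 0 = v → ∃ σ', body.Runs σ σ' ∧ (∀ b < 9, σ'.mem b = σ.mem b) ∧
        σ'.buf = σ.buf ++ (open Classical in if R I k q u v then [u, v] else []) ∧
        σ'.out = σ.out ∧ σ'.time + overhead I.n ≤ σ.time + Wv B := by
    intro k q u v hk hq hu hv σ hm h2 h4 h6 h7 h8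
    have szk := Nat.size_le_self k
    have szu := Nat.size_le_self u
    have szv := Nat.size_le_self v
    have hfits : Fits I (envOf k q u v) (B₂ B) := by
      refine ⟨by simp only [B₂, B₁]; omega, fun i => ?_⟩
      simp only [B₂]
      match i with
      | 0 => simp only [envOf, B₁]; omega
      | 1 => simp only [envOf]; omega
      | 2 => simp only [envOf, B₁]; omega
      | 3 => simp only [envOf, B₁]; omega
      | i + 4 => simp [envOf]
    obtain ⟨σ₁, r₁, v₁, m₁, b₁, o₁, t₁⟩ := (hR I _ _ hfits).2 regs 9 σ (by omega)
      (fun i => by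
        match i with
        | 0 | 1 | 2 | 3 | i + 4 => simp [regs])
      hm (fun i => by
        match i with
        | 0 => exact h4
        | 1 => exact h6
        | 2 => exact h7
        | 3 => exact h8
        | i + 4 => exact h2)
    have h7' : σ₁.mem 7 0 = u := by rw [m₁ 7 (by omega), h7]
    have h8' : σ₁.mem 8 0 = v := by rw [m₁ 8 (by omega), h8]
    simp only [envOf] at v₁
    have hc := Expr.cost_reg v₁
    by_cases hr : R I k q u v
    · rw [ind_of hr] at v₁ hc
      refine ⟨_, .seq r₁ (.ite_true (by rw [Expr.eval_reg v₁]; omega)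
        (.seq (.write _ _) (.write _ _))), m₁, ?_, o₁, ?_⟩
      · simp [hr, Expr.eval, h7', h8', b₁]
      · simp [Expr.cost, Expr.eval, h7', h8', v₁]
        simp only [Wv]
        omega
    · rw [ind_of_not hr] at v₁ hc
      refine ⟨_, .seq r₁ (.ite_false (Expr.eval_reg v₁) (.skip _)), m₁, ?_, o₁, ?_⟩
      · simp [hr, b₁]
      · simp [Expr.cost, Expr.eval, v₁]
        simp only [Wv]
        omega
  -- one row
  have hrow : ∀ k q u, k < K I → Nat.size q ≤ tN (B₁ B) → u < I.n → ∀ σ : State,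
      Holds I σ.mem → σ.mem 2 0 = 0 → σ.mem 4 0 = k → σ.mem 6 0 = q → σ.mem 7 0 = u →
      ∃ σ', (Cmd.count 8 0 body).Runs σ σ' ∧ (∀ b < 8, σ'.mem b = σ.mem b) ∧
        σ'.buf = σ.buf ++ rowWord R I k q u I.n ∧ σ'.out = σ.out ∧
        σ'.time + overhead I.n ≤ σ.time + Wu B := by
    intro k q u hk hq hu σ hm h2 h4 h6 h7
    obtain ⟨σ', r', m', b', o', t'⟩ := Cmd.count_runs (i := 8) (l := 0) (c := body) (σ := σ)
      (by omega) hm.n_eq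
      (fun j buf out t => buf = σ.buf ++ rowWord R I k q u j ∧ out = σ.out ∧
        t ≤ σ.time + j * Wv B + overhead I.n)
      (fun t ht => ⟨by simp [rowWord], rfl, by omega⟩)
      (fun j hj σ₁ hm₁ hj₁ ⟨hb, ho, ht⟩ => by
        obtain ⟨σ₂, r₂, m₂, b₂, o₂, t₂⟩ := hbody k q u j hk hq hu hj σ₁ (hm.of_eq (by omega) hm₁)
          (by rw [hm₁ 2 (by omega), h2]) (by rw [hm₁ 4 (by omega), h4])
          (by rw [hm₁ 6 (by omega), h6]) (by rw [hm₁ 7 (by omega), h7]) hj₁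
        refine ⟨σ₂, r₂, m₂, fun t ht' => ⟨?_, o₂.trans ho, ?_⟩⟩
        · rw [b₂, hb]
          simp [rowWord, List.range_succ]
        · rw [add_mul]
          omega)
    refine ⟨σ', r', m', b', o', ?_⟩
    have : I.n * Wv B ≤ B * Wv B := Nat.mul_le_mul_right _ hn
    simp only [Wu, add_mul]
    have : 60 + 8 * B ≤ Wv B := by simp only [Wv]; omega
    omega
  -- one solution
  have hsol : ∀ k q, k < K I → Nat.size q ≤ tN (B₁ B) → ∀ σ : State,
      Holds I σ.mem → σ.mem 2 0 = 0 → σ.mem 4 0 = k → σ.mem 6 0 = q → σ.buf = [] →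
      ∃ σ' t, solution.Runs σ σ' ∧ (∀ b < 7, σ'.mem b = σ.mem b) ∧ σ'.buf = [] ∧
        σ'.out = σ.out ++ [(t, relWord R I k q I.n)] ∧ σ'.time = t ∧ t ≤ σ.time + Wq B := by
    intro k q hk hq σ hm h2 h4 h6 hbuf
    obtain ⟨σ', r', m', b', o', t'⟩ := Cmd.count_runs (i := 7) (l := 0) (c := .count 8 0 body)
      (σ := σ) (by omega) hm.n_eq
      (fun j buf out t => buf = relWord R I k q j ∧ out = σ.out ∧
        t ≤ σ.time + j * Wu B + overhead I.n)
      (fun t ht => ⟨by simp [relWord, hbuf], rfl, by omega⟩)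
      (fun j hj σ₁ hm₁ hj₁ ⟨hb, ho, ht⟩ => by
        obtain ⟨σ₂, r₂, m₂, b₂, o₂, t₂⟩ := hrow k q j hk hq hj σ₁ (hm.of_eq (by omega) hm₁)
          (by rw [hm₁ 2 (by omega), h2]) (by rw [hm₁ 4 (by omega), h4])
          (by rw [hm₁ 6 (by omega), h6]) hj₁
        refine ⟨σ₂, r₂, m₂, fun t ht' => ⟨?_, o₂.trans ho, ?_⟩⟩
        · rw [b₂, hb]
          simp [relWord, List.range_succ]
        · rw [add_mul]
          omega)
    refine ⟨_, σ'.time + 1, .seq r' (.emit _), m', rfl, ?_, rfl, ?_⟩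
    · simp [b', o']
    · have : I.n * Wu B ≤ B * Wu B := Nat.mul_le_mul_right _ hn
      simp only [Wq, add_mul]
      omega
  -- one value of `k`
  have htrial : ∀ k, k < K I → ∀ (σ : State) (s : ℕ), Holds I σ.mem → σ.mem 2 0 = 0 →
      σ.mem 4 0 = k → σ.buf = [] → Delays (D B) s σ.out σ.time → s + S B ≤ D B →
      ∃ σ', trial.Runs σ σ' ∧ (∀ b < 5, σ'.mem b = σ.mem b) ∧ σ'.buf = [] ∧
        σ'.out.map Prod.snd = σ.out.map Prod.snd ++ (open Classical in if T I k then
          (List.range (N I k)).map (fun q => relWord R I k q I.n) else []) ∧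
        ∀ t ≤ overhead (K I), Delays (D B) (s + S B) σ'.out (σ'.time + t) := by
    intro k hk σ s hm h2 h4 hbuf hd hs
    have szk := Nat.size_le_self k
    have szK := Nat.size_le_self (K I)
    have hfits : Fits I (envOf k 0 0 0) (B₁ B) := by
      refine ⟨by simp only [B₁]; omega, fun i => ?_⟩
      match i with
      | 0 => simp only [envOf, B₁]; omega
      | 1 | 2 | 3 | i + 4 => simp [envOf]
    have hregs : ∀ i, regsK i < 9 := fun i => by
      match i with
      | 0 | i + 1 => simp [regsK]
    obtain ⟨σ₁, r₁, v₁, m₁, b₁, o₁, t₁⟩ := (hT I _ _ hfits).2 regsK 9 σ (by omega) hregs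
      hm (fun i => by
        match i with
        | 0 => exact h4
        | 1 | 2 | 3 | i + 4 => exact h2)
    simp only [envOf] at v₁
    have hc := Expr.cost_reg v₁
    have hoK : overhead (K I) ≤ 6 * κ B + 20 := by simp only [overhead]; omega
    have hS : S B = Wq B + tK B + tT (B₁ B) + 10 * tN (B₁ B) + 10 * κ B + 100 := rfl
    by_cases hr : T I k
    · rw [ind_of hr] at v₁ hc
      have hc' : Nat.size 1 = 1 := by simp
      obtain ⟨sN, hN'⟩ := hN I _ _ hfits
      simp only [envOf] at sN hN'
      obtain ⟨σ₂, r₂, v₂, m₂, b₂, o₂, t₂⟩ := hN' regsK 9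
        (σ₁.tick (1 + Expr.cost σ₁.mem (.reg 9))) (by omega) hregs (hm.of_eq (by omega) m₁)
        (fun i => by
          match i with
          | 0 => exact (congrFun (m₁ 4 (by omega)) 0).trans h4
          | 1 | 2 | 3 | i + 4 => exact (congrFun (m₁ 2 (by omega)) 0).trans h2)
      rw [State.tick_time] at t₂
      have hoN : overhead (N I k) ≤ 6 * tN (B₁ B) + 20 := by simp only [overhead]; omega
      set σ₃ := σ₂.assign 5 (N I k) (4 + Nat.size (N I k)) with hσ₃
      have r₃ : Cmd.Runs (.set 5 (.lit 0) (.reg 9)) σ₂ σ₃ :=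
        .assign _ (Expr.eval_reg v₂) (by rw [Expr.cost_reg v₂]; omega)
      have m₃ : ∀ b < 5, σ₃.mem b = σ.mem b := fun b hb =>
        (Mem.update_of_ne _ _ _ hb.ne).trans ((m₂ b (by omega)).trans (m₁ b (by omega)))
      have o₃ : σ₃.out = σ.out := o₂.trans o₁
      have b₃ : σ₃.buf = [] := b₂.trans (b₁.trans hbuf)
      have t₃ : σ₃.time = σ₂.time + (4 + Nat.size (N I k)) := rfl
      -- Room is left for writing one solution and for the control of the outer loop, so the silent
      -- time afterwards is at most `s + S B` even if the loop over `q` is empty.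
      let s' := s + S B - Wq B - overhead (K I)
      have hs' : s' + Wq B + overhead (K I) = s + S B := by simp only [s']; omega
      obtain ⟨σ₄, r₄, m₄, b₄, o₄, d₄⟩ := Cmd.count_runs (i := 6) (l := 5) (c := solution)
        (σ := σ₃) (N := N I k) (by omega) (by simp [hσ₃])
        (fun j buf out t => buf = [] ∧ out.map Prod.snd = σ.out.map Prod.snd ++
          (List.range j).map (fun q => relWord R I k q I.n) ∧ Delays (D B) s' out t)
        (fun t ht => ⟨b₃, by simp [o₃], by
          rw [o₃]
          exact hd.mono (r := s' - s) (by omega) (by omega)⟩)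
        (fun j hj σ₅ hm₅ hj₅ ⟨hb, ho, hd⟩ => by
          obtain ⟨σ₆, t, r₆, m₆, b₆, o₆, rfl, t₆⟩ := hsol k j hk
            ((Nat.size_le_size hj.le).trans sN) σ₅
            ((hm.of_eq (d := 5) (by omega) m₃).of_eq (d := 6) (by omega) hm₅)
            (by rw [hm₅ 2 (by omega), m₃ 2 (by omega), h2])
            (by rw [hm₅ 4 (by omega), m₃ 4 (by omega), h4]) hj₅ hb
          refine ⟨σ₆, r₆, m₆, fun t ht => ⟨b₆, ?_, ?_⟩⟩
          · rw [o₆, List.map_append, ho]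
            simp [List.range_succ]
          · have := hd.mono (s' := s' + Wq B) t₆ le_rfl
            have := this.emit (by omega) (relWord R I k j I.n)
            rw [← o₆] at this
            exact this.mono (r := t) le_rfl (by omega))
      refine ⟨σ₄, .seq r₁ (.ite_true (by rw [Expr.eval_reg v₁]; omega) (.seq r₂ (.seq r₃ r₄))),
        fun b hb => (m₄ b (by omega)).trans (m₃ b hb), b₄, by simp [o₄, hr], fun t ht => ?_⟩
      exact d₄.mono (r := t) le_rfl (by omega)
    · rw [ind_of_not hr] at v₁ hc
      have hc' : Nat.size 0 = 0 := by simp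
      refine ⟨_, .seq r₁ (.ite_false (Expr.eval_reg v₁) (.skip _)),
        fun b hb => m₁ b (by omega), b₁.trans hbuf, by simp [hr, o₁], fun t ht => ?_⟩
      change Delays _ _ σ₁.out _
      rw [o₁]
      refine hd.mono (r := S B) ?_ le_rfl
      rw [State.tick_time, State.tick_time]
      omega
  have hD : D B = (κ B + 3) * S B := rfl
  obtain ⟨sK, hK'⟩ := hK I _ _ hfit
  beta_reduce at sK
  obtain ⟨σ₁, r₁, v₁, m₁, b₁, o₁, t₁⟩ := hK' (fun _ => 2) 9 (initState I.G) (by omega)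
    (by simp) hinit (fun _ => hzero)
  beta_reduce at v₁
  set σ₂ := σ₁.assign 3 (K I) (4 + Nat.size (K I)) with hσ₂
  have r₂ : Cmd.Runs (.set 3 (.lit 0) (.reg 9)) σ₁ σ₂ :=
    .assign _ (Expr.eval_reg v₁) (by rw [Expr.cost_reg v₁]; omega)
  have m₂ : ∀ b < 3, σ₂.mem b = inputMem I.G b := fun b hb =>
    (Mem.update_of_ne _ _ _ hb.ne).trans (m₁ b (by omega))
  have o₂ : σ₂.out = [] := o₁
  have b₂ : σ₂.buf = [] := b₁
  have t₂ : σ₂.time ≤ tK B + (4 + Nat.size (K I)) := by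
    have : (initState I.G).time = 0 := rfl
    rw [hσ₂, State.assign_time]
    omega
  have szK := Nat.size_le_self (K I)
  -- In the invariant `(j + 1) * S B`, one `S B` is for the preparation and one for each value of
  -- `k` already treated.
  obtain ⟨σ₃, r₃, -, -, o₃, d₃⟩ := Cmd.count_runs (i := 4) (l := 3) (c := trial)
    (σ := σ₂) (N := K I) (by omega) (by simp [hσ₂])
    (fun j buf out t => buf = [] ∧ out.map Prod.snd =
      (indexList T N I j).map (fun p => relWord R I p.1 p.2 I.n) ∧ Delays (D B) ((j + 1) * S B) out t)
    (fun t ht => ⟨b₂, by simp [o₂, indexList], by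
      rw [o₂]
      refine ⟨by simp, fun a ha => ?_⟩
      simp only [overhead] at ht
      simp only [S]
      omega⟩)
    (fun j hj σ₄ hm₄ hj₄ ⟨hb, ho, hd⟩ => by
      have h1 : (j + 1) * S B + S B ≤ D B := by
        rw [hD, ← Nat.succ_mul]
        exact Nat.mul_le_mul_right _ (by omega)
      obtain ⟨σ₅, r₅, m₅, b₅, o₅, d₅⟩ := htrial j hj σ₄ _
        ((hinit.of_eq (d := 3) (by omega) m₂).of_eq (d := 4) (by omega) hm₄)
        (by rw [hm₄ 2 (by omega), m₂ 2 (by omega), hzero]) hj₄ hb hd h1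
      refine ⟨σ₅, r₅, m₅, fun t ht => ⟨b₅, ?_, ?_⟩⟩
      · rw [o₅, ho]
        simp only [indexList, List.range_succ, List.flatMap_append, List.map_append]
        congr 1
        by_cases h : T I j <;> simp [h]
      · rw [add_mul _ _ (S B), one_mul]
        exact d₅ t ht)
  refine ⟨σ₃, .seq r₁ (.seq r₂ r₃), o₃, d₃.chain ?_⟩
  rw [hD]
  exact Nat.mul_le_mul_right _ (by omega)

end Scheme

/-! ### Counting and quantifying over vertices -/

/-- The number of `j < v` with `p j`. -/
noncomputable def numLt (p : ℕ → Prop) (v : ℕ) : ℕ := open Classical in Nat.count p v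

open Classical in
theorem numLt_eq_sum {n : ℕ} {p : ℕ → Prop} (hp : ∀ j, p j → j < n) (v : ℕ) :
    numLt p v = ∑ j ∈ Finset.range n, ind (j < v ∧ p j) := by
  have h : numLt p v = ((Finset.range n).filter fun j => j < v ∧ p j).card := by
    rw [numLt, Nat.count_eq_card_filter_range]
    congr 1
    ext j
    simp only [Finset.mem_filter, Finset.mem_range]
    exact ⟨fun h => ⟨hp j h.2, h⟩, fun h => h.2⟩
  rw [h, Finset.card_filter]
  refine Finset.sum_congr rfl fun j _ => ?_
  by_cases h : j < v ∧ p j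
  · rw [if_pos h, ind_of h]
  · rw [if_neg h, ind_of_not h]

/-- The value of `g` may be exponential, so the sum runs over the vertices instead of the numbers
below `g`; this suffices because `p` holds only at vertices. -/
theorem Feasible.numLt {p : Inst → Env → ℕ → Prop} {g : Inst → Env → ℕ}
    (hb : ∀ I e j, p I e j → j < I.n)
    (hp : Decides (fun I e => p I (fun i => e (i + 1)) (e 0))) (hg : Feasible g) :
    Feasible (fun I e => numLt (p I e) (g I e)) :=
  (Feasible.sum (g := fun I e j => ind (j < g I e ∧ p I e j)) .order .order
    ((Decides.lt (.var 0) (hg.rename Nat.succ)).and hp)).congr fun I e =>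
      (numLt_eq_sum (hb I e) _).symm

theorem Decides.exists_vertex {p : Inst → Env → ℕ → Prop}
    (hp : Decides (fun I e => p I (fun i => e (i + 1)) (e 0))) :
    Decides (fun I e => ∃ j < I.n, p I e j) := .exists_lt .order .order hp

theorem Decides.forall_vertex {p : Inst → Env → ℕ → Prop}
    (hp : Decides (fun I e => p I (fun i => e (i + 1)) (e 0))) :
    Decides (fun I e => ∀ j < I.n, p I e j) := .forall_lt .order .order hp

/-! ## The vertex cover -/

/-- Adjacency, as a relation on the natural numbers. -/
def Inst.Adj (I : Inst) (u v : ℕ) : Prop :=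
  ∃ (hu : u < I.n) (hv : v < I.n), I.G.Adj ⟨u, hu⟩ ⟨v, hv⟩

namespace Inst

variable {I : Inst} {u v w x : ℕ}

theorem Adj.left_lt (h : I.Adj u v) : u < I.n := h.1
theorem Adj.right_lt (h : I.Adj u v) : v < I.n := h.2.1
theorem Adj.symm (h : I.Adj u v) : I.Adj v u := ⟨h.2.1, h.1, h.2.2.symm⟩
theorem Adj.ne (h : I.Adj u v) : u ≠ v := by
  rintro rfl
  exact h.2.2.ne rfl

/-- Testing that the column is below `n` makes the matrix index decode uniquely; a nonzero entry
then also forces the row to be below `n`. -/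
theorem decides_adj : Decides₂ Inst.Adj := by
  refine ((Decides.lt (.var 1) .order).and (Decides.ne_zero
    (Feasible.input (((Feasible.var 0).mul .order).add (.var 1))))).congr fun I e => ?_
  simp only [inputMem]
  constructor
  · rintro ⟨h1, h⟩
    have h : ∃ u v : Fin I.n, I.G.Adj u v ∧ e 0 * I.n + e 1 = u * I.n + v := by
      by_contra h'
      simp [h'] at h
    obtain ⟨u, v, ha, he⟩ := h
    have hn : 0 < I.n := by omega
    have e1 : e 1 = v := by
      have := congrArg (· % I.n) he
      simpa [Nat.mod_eq_of_lt h1, Nat.mod_eq_of_lt v.2] using this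
    have e0 : e 0 = u := by
      rw [e1] at he
      exact Nat.eq_of_mul_eq_mul_right hn (by omega)
    rw [e0, e1]
    exact ⟨u.2, v.2, ha⟩
  · rintro ⟨h0, h1, ha⟩
    refine ⟨h1, ?_⟩
    have : ∃ u v : Fin I.n, I.G.Adj u v ∧ e 0 * I.n + e 1 = u * I.n + v := ⟨_, _, ha, rfl⟩
    simp [this]

/-- The vertices of a maximal matching that is found greedily among the first `p` pairs of vertices. -/
noncomputable def greedy (I : Inst) : ℕ → Finset ℕ
  | 0 => ∅
  | p + 1 => open Classical in
    if I.Adj (p / I.n) (p % I.n) ∧ p / I.n ∉ greedy I p ∧ p % I.n ∉ greedy I p then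
      insert (p / I.n) (insert (p % I.n) (greedy I p)) else greedy I p

/-- A vertex cover: the vertices of a maximal matching. -/
noncomputable def cover (I : Inst) : Finset ℕ := greedy I (I.n * I.n)

theorem lt_of_mem_greedy {p : ℕ} (h : x ∈ greedy I p) : x < I.n := by
  induction p with
  | zero => simp [greedy] at h
  | succ p ih =>
    rw [greedy] at h
    split_ifs at h with h'
    · simp only [Finset.mem_insert] at h
      rcases h with rfl | rfl | h
      · exact h'.1.left_lt
      · exact h'.1.right_lt
      · exact ih h
    · exact ih h

theorem lt_of_mem_cover (h : x ∈ I.cover) : x < I.n := lt_of_mem_greedy h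

theorem greedy_subset_succ (p : ℕ) : greedy I p ⊆ greedy I (p + 1) := by
  rw [greedy]
  split_ifs
  · exact (Finset.subset_insert _ _).trans (Finset.subset_insert _ _)
  · exact subset_rfl

/-- When the greedy algorithm meets the pair, one of the two vertices is already matched or both are
inserted, and nothing is removed later. -/
theorem Adj.mem_cover (h : I.Adj u v) : u ∈ I.cover ∨ v ∈ I.cover := by
  have hmono : Monotone (greedy I) := monotone_nat_of_le_succ greedy_subset_succ
  have hu := h.left_lt
  have hv := h.right_lt
  have hn : 0 < I.n := by omega
  have hlt : u * I.n + v + 1 ≤ I.n * I.n := by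
    have : (u + 1) * I.n ≤ I.n * I.n := Nat.mul_le_mul_right _ hu
    rw [add_mul] at this
    omega
  have h1 : (u * I.n + v) / I.n = u := by
    rw [mul_comm, Nat.mul_add_div hn, Nat.div_eq_of_lt hv, add_zero]
  have h2 : (u * I.n + v) % I.n = v := by
    rw [mul_comm, Nat.mul_add_mod, Nat.mod_eq_of_lt hv]
  have : u ∈ greedy I (u * I.n + v + 1) ∨ v ∈ greedy I (u * I.n + v + 1) := by
    rw [greedy, h1, h2]
    split_ifs with h'
    · simp
    · tauto
  exact this.imp (fun h => hmono hlt h) (fun h => hmono hlt h)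

/-- Each insertion adds the two ends of an edge, and the cover `Y` contains at least one of these
new vertices. -/
theorem card_greedy_le (Y : Finset ℕ) (hY : ∀ u v, I.Adj u v → u ∈ Y ∨ v ∈ Y) (p : ℕ) :
    (greedy I p).card ≤ 2 * (Y ∩ greedy I p).card := by
  induction p with
  | zero => simp [greedy]
  | succ p ih =>
    rw [greedy]
    split_ifs with h'
    · obtain ⟨ha, hu, hv⟩ := h'
      have hne := ha.ne
      have huv : p / I.n ∉ insert (p % I.n) (greedy I p) := by simp [hne, hu]
      rw [Finset.card_insert_of_notMem huv, Finset.card_insert_of_notMem hv]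
      have : (Y ∩ greedy I p).card + 1 ≤
          (Y ∩ insert (p / I.n) (insert (p % I.n) (greedy I p))).card := by
        rcases hY _ _ ha with h | h
        · rw [← Finset.card_insert_of_notMem (a := p / I.n) (by simp [hu])]
          refine Finset.card_le_card fun z hz => ?_
          simp only [Finset.mem_insert, Finset.mem_inter] at hz ⊢
          grind
        · rw [← Finset.card_insert_of_notMem (a := p % I.n) (by simp [hv])]
          refine Finset.card_le_card fun z hz => ?_
          simp only [Finset.mem_insert, Finset.mem_inter] at hz ⊢
          grind
      omega
    · exact ih

theorem card_cover_le : I.cover.card ≤ 2 * I.G.vertexCoverNum.toNat := by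
  classical
  obtain ⟨s, hs, hc⟩ := SimpleGraph.vertexCoverNum_exists I.G
  have hfin : s.Finite := s.toFinite
  rw [← hs, hfin.encard_eq_coe_toFinset_card, ENat.toNat_natCast]
  refine (card_greedy_le (hfin.toFinset.map Fin.valEmbedding) ?_ _).trans ?_
  · rintro u v ⟨hu, hv, ha⟩
    refine (hc ha).imp (fun h => ?_) (fun h => ?_) <;>
      exact Finset.mem_map.2 ⟨_, hfin.mem_toFinset.2 h, rfl⟩
  · refine Nat.mul_le_mul_left _ ((Finset.card_le_card Finset.inter_subset_left).trans ?_)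
    rw [Finset.card_map]

theorem testBit_sum_two_pow (s : Finset ℕ) (i : ℕ) :
    (∑ x ∈ s, 2 ^ x).testBit i = true ↔ i ∈ s := by
  rw [← Nat.mem_bitIndices, ← List.mem_toFinset, Finset.toFinset_bitIndices_sum_two_pow]

/-- Bit `p` of `a`, for `p ≤ 2n`. -/
def Bit (I : Inst) (a p : ℕ) : Prop := a / 2 ^ min p (I.n + I.n) % 2 = 1

/-- The cap in `Bit` keeps the exponent small, as `Feasible.pow` requires. It does no harm: codes
have at most 2|X| ≤ 2n bits and vertex sets at most n. -/
theorem bit_iff {a p : ℕ} (h : p ≤ I.n + I.n) : I.Bit a p ↔ a.testBit p := by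
  rw [Bit, min_eq_left h, Nat.testBit_eq_decide_div_mod_eq]
  simp

theorem decides_bit : Decides₂ Bit := by
  refine Decides.eq (.mod (.div (.var 0) (.pow (.const 2) (.min (.var 1) (.add .order .order)) ?_))
    (.const 2)) (.const 1)
  exact (Small.order.add .order).mono fun I e => min_le_right _ _

/-- One step of the greedy matching algorithm, on bit masks. -/
noncomputable def greedyStep (I : Inst) (e : Env) : ℕ := open Classical in
  if I.Adj (e 1 / I.n) (e 1 % I.n) ∧ ¬I.Bit (e 0) (e 1 / I.n) ∧ ¬I.Bit (e 0) (e 1 % I.n) then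
    2 ^ min (e 1 / I.n) I.n + (2 ^ min (e 1 % I.n) I.n + e 0) else e 0

/-- A set of vertices is stored as a number below `2 ^ n`, so the greedy algorithm is a recursion
with short accumulators. A new vertex is inserted by adding its power of two. -/
theorem feasible_mask : Feasible₀ (fun I => ∑ x ∈ I.cover, 2 ^ x) := by
  have hu : Feasible (fun I e => e 1 / I.n) := .div (.var 1) .order
  have hv : Feasible (fun I e => e 1 % I.n) := .mod (.var 1) .order
  have hpow : ∀ {f : Inst → Env → ℕ}, Feasible f → Feasible (fun I e => 2 ^ min (f I e) I.n) :=
    fun hf => .pow (.const 2) (.min hf .order) (Small.order.mono fun I e => min_le_right _ _)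
  have hstep : Feasible greedyStep := open Classical in Feasible.cond
    ((decides_adj.comp hu hv).and (((decides_bit.comp (.var 0) hu).not).and
      (decides_bit.comp (.var 0) hv).not))
    ((hpow hu).add ((hpow hv).add (.var 0))) (.var 0)
  have hit : ∀ I e j, Feasible.iterate (fun _ _ => 0) greedyStep I e j = ∑ x ∈ greedy I j, 2 ^ x := by
    intro I e j
    induction j with
    | zero => rfl
    | succ j ih =>
      rw [Feasible.iterate, ih, greedy]
      have hb : ∀ p < I.n, I.Bit (∑ x ∈ greedy I j, 2 ^ x) p ↔ p ∈ greedy I j := fun p hp => by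
        rw [bit_iff (by omega), testBit_sum_two_pow]
      have hc : (I.Adj (j / I.n) (j % I.n) ∧ ¬I.Bit (∑ x ∈ greedy I j, 2 ^ x) (j / I.n) ∧
          ¬I.Bit (∑ x ∈ greedy I j, 2 ^ x) (j % I.n)) ↔
          I.Adj (j / I.n) (j % I.n) ∧ j / I.n ∉ greedy I j ∧ j % I.n ∉ greedy I j :=
        and_congr_right fun ha => by rw [hb _ ha.left_lt, hb _ ha.right_lt]
      by_cases h' : I.Adj (j / I.n) (j % I.n) ∧ j / I.n ∉ greedy I j ∧ j % I.n ∉ greedy I j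
      · refine (if_pos (hc.2 h')).trans ?_
        rw [if_pos h', Finset.sum_insert (by simp [h'.1.ne, h'.2.1]),
          Finset.sum_insert h'.2.2, Env.cons_zero, Env.cons_one, Env.cons_zero,
          min_eq_left h'.1.left_lt.le, min_eq_left h'.1.right_lt.le]
      · refine (if_neg (mt hc.1 h')).trans ?_
        rw [if_neg h', Env.cons_zero]
  refine (Feasible.iter (lim := fun I _ => I.n * I.n) (.mul .order .order) (.const 0) hstep
    (.mul .order .order) (s := fun B => B) (by fun_prop) ?_).congr fun I e => hit I e _
  intro I e B h j _
  rw [hit, Nat.size_le]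
  exact (Nat.geomSum_lt le_rfl fun k hk => lt_of_mem_greedy hk).trans_le
    (Nat.pow_le_pow_right (by omega) h.n_le)

theorem decides_cover : Decides₁ (fun I x => x ∈ I.cover) :=
  ((Decides.lt (.var 0) .order).and (decides_bit.comp feasible_mask (.var 0))).congr fun I e => by
    constructor
    · rintro ⟨h, h'⟩
      rwa [bit_iff (by omega), testBit_sum_two_pow] at h'
    · intro h
      have := lt_of_mem_cover h
      refine ⟨this, ?_⟩
      rwa [bit_iff (by omega), testBit_sum_two_pow]

end Inst

namespace Inst

/-! ## The algorithm

A number `k < codes` describes a colouring of the vertices with two colours: the bits of `k` give the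
colours of the vertices in the cover, and break ties for the other vertices, which are coloured like
the majority of their neighbours. -/

/-- The number of codes. -/
noncomputable def codes (I : Inst) : ℕ := 2 ^ (I.cover.card + I.cover.card)

/-- The colour of the vertex `x` of the cover. -/
def CoverCol (I : Inst) (k x : ℕ) : Prop := I.Bit k (numLt (fun y => y ∈ I.cover) x)

/-- The number of neighbours of `v` in the cover with the first colour. -/
noncomputable def ones (I : Inst) (k v : ℕ) : ℕ :=
  numLt (fun x => I.Adj v x ∧ x ∈ I.cover ∧ I.CoverCol k x) I.n

/-- The number of neighbours of `v` in the cover with the second colour. -/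
noncomputable def zeros (I : Inst) (k v : ℕ) : ℕ :=
  numLt (fun x => I.Adj v x ∧ x ∈ I.cover ∧ ¬I.CoverCol k x) I.n

/-- There is a tie between the colours of the neighbours of `v`. -/
def Tied (I : Inst) (k v : ℕ) : Prop :=
  v ∉ I.cover ∧ I.zeros k v = I.ones k v ∧ I.ones k v ≠ 0

/-- The colour of `v`. -/
def Col (I : Inst) (k v : ℕ) : Prop :=
  (v ∈ I.cover ∧ I.CoverCol k v) ∨ (v ∉ I.cover ∧ (I.zeros k v < I.ones k v ∨
    (I.Tied k v ∧ I.Bit k (I.cover.card + numLt (I.Tied k) v))))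

/-- The edge cut of the colouring. -/
def Core (I : Inst) (k u v : ℕ) : Prop := I.Adj u v ∧ ¬(I.Col k u ↔ I.Col k v)

/-- The edge cut of the colouring is a matching. -/
def Valid (I : Inst) (k : ℕ) : Prop :=
  ∀ u < I.n, ∀ v < I.n, ∀ w < I.n, I.Core k u v → I.Core k u w → v = w

def SubCore (I : Inst) (k l : ℕ) : Prop := ∀ u < I.n, ∀ v < I.n, I.Core k u v → I.Core l u v

def EmptyCore (I : Inst) (k : ℕ) : Prop := ∀ u < I.n, ∀ v < I.n, ¬I.Core k u v

/-- No smaller code gives the same edge cut. -/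
def First (I : Inst) (k : ℕ) : Prop := ∀ l < I.codes, l < k → ¬(I.SubCore l k ∧ I.SubCore k l)

/-- The vertex `x` meets the edge cut. -/
def Sat (I : Inst) (k x : ℕ) : Prop := ∃ w < I.n, I.Core k x w

/-- The vertex `v` outside the cover has exactly one neighbour. -/
def Pend (I : Inst) (v : ℕ) : Prop := v ∉ I.cover ∧ numLt (I.Adj v) I.n = 1

/-- The neighbour of a pendant vertex. -/
noncomputable def nb (I : Inst) (v : ℕ) : ℕ := ∑ x ∈ Finset.range I.n, ind (I.Adj v x) * x

/-- The number of pendant neighbours of `x`. -/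
noncomputable def pendCount (I : Inst) (x : ℕ) : ℕ := numLt (fun v => I.Pend v ∧ I.Adj v x) I.n

/-- The number of smaller pendant vertices with the same neighbour. -/
noncomputable def pendRank (I : Inst) (v : ℕ) : ℕ :=
  numLt (fun w => I.Pend w ∧ I.Adj w (I.nb v)) v

/-- The graph is disconnected. -/
def Disc (I : Inst) : Prop :=
  (2 ≤ I.n ∧ ∃ u < I.n, ∀ v < I.n, ¬I.Adj u v) ∨
    ∃ k < I.codes, I.EmptyCore k ∧ (∃ u < I.n, I.Col k u) ∧ ∃ u < I.n, ¬I.Col k u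

/-- The number of choices of a pendant edge at `x`; the choice of no edge is counted when `c = 0`
and when there is no other choice. -/
noncomputable def radix (c : ℕ) (I : Inst) (k x : ℕ) : ℕ :=
  open Classical in if I.Sat k x then 1 else max 1 (I.pendCount x + 1 - c)

/-- The digit at `x` of `q` in the mixed radix representation. -/
noncomputable def digit (c : ℕ) (I : Inst) (k q x : ℕ) : ℕ :=
  q / (∏ y ∈ Finset.range I.n, if y < x then I.radix c k y else 1) % I.radix c k x

/-- The pendant vertex `v` is selected by `q`. -/
def Sel (c : ℕ) (I : Inst) (k q v : ℕ) : Prop :=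
  I.Pend v ∧ ¬I.Sat k (I.nb v) ∧ I.digit c k q (I.nb v) + c = I.pendRank v + 1

/-- The edge cut of the colouring is empty, but this is not a matching cut. -/
def Bad (I : Inst) (k : ℕ) : Prop := I.EmptyCore k ∧ ¬I.Disc

/-- The edge cut of the colouring can be extended without touching vertices with pendant
neighbours. -/
def Extends (I : Inst) (k : ℕ) : Prop :=
  ∃ l < I.codes, I.Valid l ∧ I.SubCore k l ∧ ¬I.SubCore l k ∧
    ∀ x < I.n, I.Sat l x → I.Sat k x ∨ I.pendCount x = 0

/-- The edge cut of the colouring contains a smaller one that is not empty. -/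
def Shrinks (I : Inst) (k : ℕ) : Prop :=
  ∃ l < I.codes, I.Valid l ∧ I.SubCore l k ∧ ¬I.SubCore k l ∧ ¬I.EmptyCore l

/-- The output for the index `k` and a set `S` of pendant vertices. -/
def OutRel (I : Inst) (k : ℕ) (S : ℕ → Prop) (u v : ℕ) : Prop :=
  I.Core k u v ∨ I.Adj u v ∧ (S u ∨ S v)

/-! ### Feasibility of the algorithm -/

theorem numLt_card {s : Finset ℕ} {n : ℕ} (hs : ∀ x ∈ s, x < n) : numLt (fun x => x ∈ s) n = s.card := by
  classical
  rw [numLt, Nat.count_eq_card_filter_range]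
  congr 1
  ext x
  simpa using hs x

theorem feasible_card : Feasible₀ (fun I => I.cover.card) :=
  (Feasible.numLt (fun _ _ _ h => lt_of_mem_cover h) (decides_cover.comp (.var 0)) .order).congr
    fun _ _ => numLt_card fun _ h => lt_of_mem_cover h

theorem small_card : Small (fun I _ => I.cover.card) := by
  refine Small.order.mono fun I _ => ?_
  have : I.cover ⊆ Finset.range I.n := fun x hx => Finset.mem_range.2 (lt_of_mem_cover hx)
  simpa using Finset.card_le_card this

theorem feasible_codes : Feasible₀ codes :=
  Feasible.pow (.const 2) (feasible_card.add feasible_card) (small_card.add small_card)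

/-- Two bits for each of the at most 2τ vertices of the cover explain the term `2 ^ (4τ)` in the
scale. -/
theorem small_codes : Small (fun I _ => I.codes) := by
  refine ⟨fun B => B, by fun_prop, fun I e B h => le_trans ?_ h.1⟩
  refine le_trans (Nat.pow_le_pow_right (by omega) ?_) (Nat.le_add_left _ _)
  have := I.card_cover_le
  omega

theorem decides_coverCol : Decides₂ CoverCol :=
  decides_bit.comp (.var 0) (Feasible.numLt (p := fun I _ y => y ∈ I.cover)
    (fun _ _ _ h => lt_of_mem_cover h) (decides_cover.comp (.var 0)) (.var 1))

theorem feasible_ones : Feasible₂ ones :=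
  Feasible.numLt (p := fun I e x => I.Adj (e 1) x ∧ x ∈ I.cover ∧ I.CoverCol (e 0) x)
    (fun _ _ _ h => h.1.right_lt)
    ((decides_adj.comp (.var 2) (.var 0)).and
      ((decides_cover.comp (.var 0)).and (decides_coverCol.comp (.var 1) (.var 0)))) .order

theorem feasible_zeros : Feasible₂ zeros :=
  Feasible.numLt (p := fun I e x => I.Adj (e 1) x ∧ x ∈ I.cover ∧ ¬I.CoverCol (e 0) x)
    (fun _ _ _ h => h.1.right_lt)
    ((decides_adj.comp (.var 2) (.var 0)).and
      ((decides_cover.comp (.var 0)).and (decides_coverCol.comp (.var 1) (.var 0)).not)) .order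

theorem decides_tied : Decides₂ Tied :=
  (decides_cover.comp (.var 1)).not.and ((Decides.eq feasible_zeros feasible_ones).and
    (Decides.ne_zero feasible_ones))

theorem exists_of_numLt_ne_zero {p : ℕ → Prop} {v : ℕ} (h : numLt p v ≠ 0) : ∃ x < v, p x := by
  classical
  by_contra! h'
  exact h (Nat.count_of_forall_not fun x hx => h' x hx)

theorem Tied.lt {I : Inst} {k v : ℕ} (h : I.Tied k v) : v < I.n := by
  obtain ⟨x, _, hx⟩ := exists_of_numLt_ne_zero h.2.2
  exact hx.1.left_lt

theorem Pend.lt {I : Inst} {v : ℕ} (h : I.Pend v) : v < I.n := by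
  obtain ⟨x, _, hx⟩ := exists_of_numLt_ne_zero (p := I.Adj v) (v := I.n) (by rw [h.2]; omega)
  exact hx.left_lt

theorem decides_col : Decides₂ Col :=
  ((decides_cover.comp (.var 1)).and decides_coverCol).or
    ((decides_cover.comp (.var 1)).not.and ((Decides.lt feasible_zeros feasible_ones).or
      (decides_tied.and (decides_bit.comp (.var 0) (.add feasible_card
        (Feasible.numLt (p := fun I e => I.Tied (e 0)) (fun _ _ _ h => h.lt)
          (decides_tied.comp (.var 1) (.var 0)) (.var 1)))))))

theorem decides_core : Decides₃ Core :=
  (decides_adj.comp (.var 1) (.var 2)).and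
    ((decides_col.comp (.var 0) (.var 1)).iff (decides_col.comp (.var 0) (.var 2))).not

theorem decides_valid : Decides₁ Valid := by
  refine .forall_vertex (.forall_vertex (.forall_vertex ?_))
  exact (decides_core.comp (.var 3) (.var 2) (.var 1)).imp
    ((decides_core.comp (.var 3) (.var 2) (.var 0)).imp (.eq (.var 1) (.var 0)))

theorem decides_subCore : Decides₂ SubCore := by
  refine .forall_vertex (.forall_vertex ?_)
  exact (decides_core.comp (.var 2) (.var 1) (.var 0)).imp
    (decides_core.comp (.var 3) (.var 1) (.var 0))

theorem decides_emptyCore : Decides₁ EmptyCore := by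
  refine .forall_vertex (.forall_vertex ?_)
  exact (decides_core.comp (.var 2) (.var 1) (.var 0)).not

theorem decides_first : Decides₁ First := by
  refine .forall_lt feasible_codes small_codes (.imp (.lt (.var 0) (.var 1)) (.not ?_))
  exact (decides_subCore.comp (.var 0) (.var 1)).and (decides_subCore.comp (.var 1) (.var 0))

theorem decides_sat : Decides₂ Sat :=
  .exists_vertex (decides_core.comp (.var 1) (.var 2) (.var 0))

theorem decides_pend : Decides₁ Pend :=
  decides_cover.not.and (.eq (Feasible.numLt (p := fun I e => I.Adj (e 0))
    (fun _ _ _ h => h.right_lt) (decides_adj.comp (.var 1) (.var 0)) .order) (.const 1))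

theorem feasible_nb : Feasible₁ nb :=
  .sum (g := fun I e x => ind (I.Adj (e 0) x) * x) .order .order
    (.mul (decides_adj.comp (.var 1) (.var 0)) (.var 0))

theorem feasible_pendCount : Feasible₁ pendCount :=
  Feasible.numLt (p := fun I e v => I.Pend v ∧ I.Adj v (e 0)) (fun _ _ _ h => h.2.left_lt)
    ((decides_pend.comp (.var 0)).and (decides_adj.comp (.var 0) (.var 1))) .order

theorem feasible_pendRank : Feasible₁ pendRank :=
  Feasible.numLt (p := fun I e w => I.Pend w ∧ I.Adj w (I.nb (e 0))) (fun _ _ _ h => h.2.left_lt)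
    ((decides_pend.comp (.var 0)).and
      (decides_adj.comp (.var 0) (feasible_nb.comp (.var 1)))) (.var 0)

theorem decides_disc : Decides₀ Disc := by
  refine .or (.and (.le (.const 2) .order) (.exists_vertex (.forall_vertex
    (decides_adj.comp (.var 1) (.var 0)).not))) (.exists_lt feasible_codes small_codes ?_)
  exact (decides_emptyCore.comp (.var 0)).and
    ((Decides.exists_vertex (decides_col.comp (.var 1) (.var 0))).and
      (.exists_vertex (decides_col.comp (.var 1) (.var 0)).not))

theorem feasible_radix (c : ℕ) : Feasible₂ (radix c) := open Classical in
  .cond decides_sat (.const 1) (.max (.const 1) (.sub (.add (feasible_pendCount.comp (.var 1))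
    (.const 1)) (.const c)))

theorem feasible_digit (c : ℕ) : Feasible₃ (digit c) :=
  .mod (.div (.var 1) (.prod (g := fun I e y => if y < e 2 then I.radix c (e 0) y else 1)
    .order .order (.cond (.lt (.var 0) (.var 3)) ((feasible_radix c).comp (.var 1) (.var 0))
      (.const 1)))) ((feasible_radix c).comp (.var 0) (.var 2))

theorem decides_sel (c : ℕ) : Decides₃ (Sel c) :=
  (decides_pend.comp (.var 2)).and
    (((decides_sat.comp (.var 0) (feasible_nb.comp (.var 2))).not).and
      (.eq (.add ((feasible_digit c).comp (.var 0) (.var 1) (feasible_nb.comp (.var 2))) (.const c))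
        (.add (feasible_pendRank.comp (.var 2)) (.const 1))))

theorem decides_bad : Decides₁ Bad :=
  decides_emptyCore.and (Decides.not decides_disc)

theorem decides_extends : Decides₁ Extends := by
  refine .exists_lt feasible_codes small_codes (.and decides_valid (.and
    (decides_subCore.comp (.var 1) (.var 0)) (.and (decides_subCore.comp (.var 0) (.var 1)).not
      (.forall_vertex ?_))))
  exact (decides_sat.comp (.var 1) (.var 0)).imp ((decides_sat.comp (.var 2) (.var 0)).or
    (.eq (feasible_pendCount.comp (.var 0)) (.const 0)))

theorem decides_shrinks : Decides₁ Shrinks := by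
  refine .exists_lt feasible_codes small_codes (.and decides_valid (.and
    (decides_subCore.comp (.var 0) (.var 1)) (.and (decides_subCore.comp (.var 1) (.var 0)).not
      (decides_emptyCore.comp (.var 0)).not)))

theorem decides_outRel {S : Inst → ℕ → ℕ → ℕ → Prop} (hS : Decides₃ S) :
    Decides (fun I e => e 2 < e 3 ∧ I.OutRel (e 0) (S I (e 0) (e 1)) (e 2) (e 3)) :=
  .and (.lt (.var 2) (.var 3)) (.or (decides_core.comp (.var 0) (.var 2) (.var 3))
    (.and (decides_adj.comp (.var 2) (.var 3)) (.or (hS.comp (.var 0) (.var 1) (.var 2))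
      (hS.comp (.var 0) (.var 1) (.var 3)))))

end Inst

/-! ### Ranks and cardinalities -/

theorem numLt_eq_card (p : ℕ → Prop) [DecidablePred p] (v : ℕ) :
    numLt p v = ((Finset.range v).filter p).card := by
  rw [numLt, Nat.count_eq_card_filter_range]
  congr!

theorem numLt_ne_zero {p : ℕ → Prop} {x v : ℕ} (hx : x < v) (h : p x) : numLt p v ≠ 0 := by
  classical
  rw [numLt_eq_card]
  exact Finset.card_ne_zero_of_mem (Finset.mem_filter.2 ⟨Finset.mem_range.2 hx, h⟩)

theorem numLt_eq_zero {p : ℕ → Prop} {v : ℕ} (h : ∀ x < v, ¬p x) : numLt p v = 0 := by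
  by_contra h'
  obtain ⟨x, hx, hp⟩ := Inst.exists_of_numLt_ne_zero h'
  exact h x hx hp

theorem numLt_lt_numLt {p : ℕ → Prop} {x v : ℕ} (hx : x < v) (h : p x) : numLt p x < numLt p v := by
  classical
  exact Nat.count_strict_mono h hx

theorem numLt_injective {p : ℕ → Prop} {x y : ℕ} (hx : p x) (hy : p y) (h : numLt p x = numLt p y) :
    x = y := by
  classical
  exact Nat.count_injective hx hy h

theorem exists_numLt_eq {p : ℕ → Prop} {j n : ℕ} (h : j < numLt p n) :
    ∃ v < n, p v ∧ numLt p v = j := by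
  classical
  induction n with
  | zero => simp [numLt] at h
  | succ n ih =>
    by_cases hj : j < numLt p n
    · obtain ⟨v, hv, h'⟩ := ih hj
      exact ⟨v, by omega, h'⟩
    · have h1 : numLt p (n + 1) = numLt p n + if p n then 1 else 0 := Nat.count_succ p n
      split_ifs at h1 with hp
      · exact ⟨n, by omega, hp, by omega⟩
      · omega

theorem numLt_le_one {p : ℕ → Prop} {n : ℕ} (h : ∀ x y, p x → p y → x = y) : numLt p n ≤ 1 := by
  classical
  rw [numLt_eq_card, Finset.card_le_one]
  intro a ha b hb
  exact h a b (Finset.mem_filter.1 ha).2 (Finset.mem_filter.1 hb).2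

theorem numLt_split (p q : ℕ → Prop) (n : ℕ) :
    numLt p n = numLt (fun x => p x ∧ q x) n + numLt (fun x => p x ∧ ¬q x) n := by
  classical
  simp only [numLt_eq_card, ← Finset.filter_filter]
  exact (Finset.card_filter_add_card_filter_not _).symm

namespace Inst

variable {I : Inst} {k l u v w x : ℕ}

/-! ## Pendant vertices -/

theorem Pend.unique (h : I.Pend v) (hu : I.Adj v u) (hw : I.Adj v w) : u = w := by
  classical
  have h1 := h.2
  rw [numLt_eq_card, Finset.card_eq_one] at h1
  obtain ⟨a, ha⟩ := h1
  have hmem : ∀ z, I.Adj v z → z = a := fun z hz => by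
    have : z ∈ (Finset.range I.n).filter (I.Adj v) := by simp [hz, hz.right_lt]
    simpa [ha] using this
  rw [hmem u hu, hmem w hw]

theorem Pend.exists_adj (h : I.Pend v) : ∃ x, I.Adj v x := by
  obtain ⟨x, _, hx⟩ := exists_of_numLt_ne_zero (p := I.Adj v) (v := I.n) (by rw [h.2]; omega)
  exact ⟨x, hx⟩

theorem Pend.nb_eq (h : I.Pend v) (hx : I.Adj v x) : I.nb v = x := by
  rw [nb, Finset.sum_eq_single x]
  · simp [ind_of hx]
  · intro y _ hy
    rw [ind_of_not fun h' => hy (h.unique h' hx), zero_mul]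
  · intro h'
    simp [hx.right_lt] at h'

theorem Pend.adj_nb (h : I.Pend v) : I.Adj v (I.nb v) := by
  obtain ⟨x, hx⟩ := h.exists_adj
  rwa [h.nb_eq hx]

theorem Pend.nb_mem (h : I.Pend v) : I.nb v ∈ I.cover :=
  h.adj_nb.mem_cover.resolve_left h.1

theorem Pend.not_pend_nb (h : I.Pend v) : ¬I.Pend (I.nb v) := fun h' => h'.1 h.nb_mem

/-- The single neighbour is the majority and leaves no room for a tie. Consequently no core contains
a pendant edge. -/
theorem Pend.col_iff (h : I.Pend v) : I.Col k v ↔ I.Col k (I.nb v) := by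
  have hx := h.adj_nb
  have hn := hx.right_lt
  have hm := h.nb_mem
  have hC : I.Col k (I.nb v) ↔ I.CoverCol k (I.nb v) := by simp [Col, hm]
  rw [hC]
  by_cases hc : I.CoverCol k (I.nb v)
  · have h1 : I.ones k v ≠ 0 := numLt_ne_zero hn ⟨hx, hm, hc⟩
    have h0 : I.zeros k v = 0 := numLt_eq_zero fun y _ hy => hy.2.2 (by rwa [← h.nb_eq hy.1])
    simp only [hc, iff_true]
    exact .inr ⟨h.1, .inl (by omega)⟩
  · have h1 : I.ones k v = 0 := numLt_eq_zero fun y _ hy => hc (by rw [h.nb_eq hy.1]; exact hy.2.2)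
    simp [hc, Col, Tied, h1, h.1]

theorem Core.symm (h : I.Core k u v) : I.Core k v u := ⟨h.1.symm, fun h' => h.2 h'.symm⟩

theorem Core.not_pend_left (h : I.Core k u v) : ¬I.Pend u := fun hp => by
  have := hp.nb_eq h.1
  exact h.2 (this ▸ hp.col_iff)

theorem Core.not_pend_right (h : I.Core k u v) : ¬I.Pend v := h.symm.not_pend_left

theorem Core.sat (h : I.Core k u v) : I.Sat k u := ⟨v, h.1.right_lt, h⟩

theorem Valid.eq (hk : I.Valid k) (hv : I.Core k u v) (hw : I.Core k u w) : v = w :=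
  hk u hv.1.left_lt v hv.1.right_lt w hw.1.right_lt hv hw

theorem SubCore.core (h : I.SubCore k l) (hc : I.Core k u v) : I.Core l u v :=
  h u hc.1.left_lt v hc.1.right_lt hc

theorem EmptyCore.not_core (h : I.EmptyCore k) : ¬I.Core k u v :=
  fun hc => h u hc.1.left_lt v hc.1.right_lt hc

/-! ## Every colouring has a code -/

/-- `A` cuts the graph in a matching. -/
def CutsMatching (I : Inst) (A : ℕ → Prop) : Prop :=
  ∀ u v w, I.Adj u v → ¬(A u ↔ A v) → I.Adj u w → ¬(A u ↔ A w) → v = w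

/-- The low bits record `A` on the cover and the high bits record `A` on the tied vertices, each by
rank. Isolated vertices are left out because no bit speaks about them, pendant ones because their
code colour follows the neighbour and not `A`. -/
theorem exists_code {A : ℕ → Prop} (hA : I.CutsMatching A) :
    ∃ k < I.codes, ∀ v, ¬I.Pend v → (∃ x, I.Adj v x) → (I.Col k v ↔ A v) := by
  classical
  set m := I.cover.card with hm
  set r := numLt (fun y => y ∈ I.cover) with hr
  let one : ℕ → ℕ := fun v => numLt (fun x => I.Adj v x ∧ x ∈ I.cover ∧ A x) I.n
  let zero : ℕ → ℕ := fun v => numLt (fun x => I.Adj v x ∧ x ∈ I.cover ∧ ¬A x) I.n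
  let tied : ℕ → Prop := fun v => v ∉ I.cover ∧ zero v = one v ∧ one v ≠ 0
  have hmn : m ≤ I.n := by
    have : I.cover ⊆ Finset.range I.n := fun x hx => Finset.mem_range.2 (lt_of_mem_cover hx)
    simpa using Finset.card_le_card this
  have hrlt : ∀ x ∈ I.cover, r x < m := fun x hx => by
    rw [hm, ← numLt_card (n := I.n) fun _ h => lt_of_mem_cover h]
    exact numLt_lt_numLt (p := fun y => y ∈ I.cover) (lt_of_mem_cover hx) hx
  have htlt : ∀ v, tied v → v < I.n := fun v hv => by
    obtain ⟨x, _, hx⟩ := exists_of_numLt_ne_zero hv.2.2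
    exact hx.1.left_lt
  -- a tied vertex has a private neighbour in the cover
  have hpart : ∀ v, tied v → ∃ x ∈ I.cover, I.Adj v x ∧ ¬(A v ↔ A x) := fun v hv => by
    obtain ⟨x, _, hx⟩ := exists_of_numLt_ne_zero hv.2.2
    obtain ⟨y, _, hy⟩ := exists_of_numLt_ne_zero (hv.2.1 ▸ hv.2.2 : zero v ≠ 0)
    by_cases h : A v
    · exact ⟨y, hy.2.1, hy.1, by have := hy.2.2; tauto⟩
    · exact ⟨x, hx.2.1, hx.1, by have := hx.2.2; tauto⟩
  have htcard : numLt tied I.n ≤ m := by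
    rw [numLt_eq_card]
    -- Two tied vertices with the same image would both be cut from it, against the matching
    -- condition at that vertex.
    choose! f hf using hpart
    refine Finset.card_le_card_of_injOn f (fun v hv => (hf v (Finset.mem_filter.1 hv).2).1) ?_
    intro v hv w hw hvw
    obtain ⟨-, av, cv⟩ := hf v (Finset.mem_filter.1 hv).2
    obtain ⟨-, aw, cw⟩ := hf w (Finset.mem_filter.1 hw).2
    rw [← hvw] at aw cw
    exact hA (f v) v w av.symm (fun h => cv h.symm) aw.symm (fun h => cw h.symm)
  have htrank : ∀ v, tied v → m + numLt tied v < m + m := fun v hv => by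
    have := numLt_lt_numLt (htlt v hv) hv
    omega
  let bits : Finset ℕ := (Finset.range (m + m)).filter fun j =>
    (∃ x ∈ I.cover, A x ∧ j = r x) ∨ ∃ v, tied v ∧ A v ∧ j = m + numLt tied v
  have hbit : ∀ j < m + m, I.Bit (∑ x ∈ bits, 2 ^ x) j ↔
      (∃ x ∈ I.cover, A x ∧ j = r x) ∨ ∃ v, tied v ∧ A v ∧ j = m + numLt tied v := fun j hj => by
    rw [bit_iff (by omega), testBit_sum_two_pow, Finset.mem_filter]
    simp [hj]
  generalize hk : ∑ x ∈ bits, 2 ^ x = k at hbit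
  have hcov : ∀ x ∈ I.cover, (I.CoverCol k x ↔ A x) := fun x hx => by
    have := hrlt x hx
    rw [CoverCol, hbit _ (show r x < m + m by omega)]
    constructor
    · rintro (⟨y, hy, ha, h⟩ | ⟨v, _, _, h⟩)
      · rwa [numLt_injective (p := fun y => y ∈ I.cover) hx hy h]
      · change r x = _ at h
        omega
    · exact fun h => .inl ⟨x, hx, h, rfl⟩
  have hone : ∀ v, I.ones k v = one v := fun v => by
    simp only [ones, one]
    congr 1
    funext x
    exact propext (and_congr_right fun _ => and_congr_right fun hx => hcov x hx)
  have hzero : ∀ v, I.zeros k v = zero v := fun v => by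
    simp only [zeros, zero]
    congr 1
    funext x
    exact propext (and_congr_right fun _ => and_congr_right fun hx => not_congr (hcov x hx))
  have htied : I.Tied k = tied := by
    funext v
    simp only [Tied, tied, hone, hzero]
  have htbit : ∀ v, tied v → (I.Bit k (m + numLt tied v) ↔ A v) := fun v hv => by
    rw [hbit _ (htrank v hv)]
    constructor
    · rintro (⟨y, hy, ha, h⟩ | ⟨w, hw, ha, h⟩)
      · have := hrlt y hy
        omega
      · rwa [numLt_injective hv hw (by omega)]
    · exact fun h => .inr ⟨v, hv, h, rfl⟩
  refine ⟨k, ?_, fun v hp hv => ?_⟩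
  · rw [← hk]
    exact Nat.geomSum_lt le_rfl fun j hj => Finset.mem_range.1 (Finset.mem_filter.1 hj).1
  by_cases hvc : v ∈ I.cover
  · simp [Col, hvc, hcov v hvc]
  have hcol : I.Col k v ↔ zero v < one v ∨ (tied v ∧ A v) := by
    simp only [Col, hvc, false_and, false_or, not_false_eq_true, true_and, hone, hzero, htied]
    exact or_congr_right (and_congr_right fun ht => htbit v ht)
  have hdeg : numLt (I.Adj v) I.n = one v + zero v := by
    rw [numLt_split _ A]
    simp only [one, zero]
    congr 2 <;> funext x <;>
      exact propext ⟨fun h => ⟨h.1, h.1.mem_cover.resolve_left hvc, h.2⟩, fun h => ⟨h.1, h.2.2⟩⟩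
  have hdeg1 : numLt (I.Adj v) I.n ≠ 1 := fun h => hp ⟨hvc, h⟩
  have hdeg0 : numLt (I.Adj v) I.n ≠ 0 := by
    obtain ⟨x, hx⟩ := hv
    exact numLt_ne_zero hx.right_lt hx
  rw [hcol]
  -- The degree is at least two and at most one neighbour has the other colour, so `A v` is the
  -- strict majority or there is one neighbour of each colour.
  by_cases hAv : A v
  · have h1 : zero v ≤ 1 := numLt_le_one fun x y hx hy => by
      exact hA v x y hx.1 (by have := hx.2.2; tauto) hy.1 (by have := hy.2.2; tauto)
    simp only [hAv, and_true, iff_true]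
    by_cases hlt : zero v < one v
    · exact .inl hlt
    · exact .inr ⟨hvc, by omega, by omega⟩
  · have h1 : one v ≤ 1 := numLt_le_one fun x y hx hy => by
      exact hA v x y hx.1 (by have := hx.2.2; tauto) hy.1 (by have := hy.2.2; tauto)
    simp only [hAv, and_false, iff_false, or_false]
    omega

theorem exists_first (hk : k < I.codes) :
    ∃ l < I.codes, I.First l ∧ I.SubCore l k ∧ I.SubCore k l := by
  classical
  have hex : ∃ l, l < I.codes ∧ I.SubCore l k ∧ I.SubCore k l :=
    ⟨k, hk, fun _ _ _ _ h => h, fun _ _ _ _ h => h⟩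
  obtain ⟨h1, h2, h3⟩ := Nat.find_spec hex
  refine ⟨Nat.find hex, h1, fun l hl hlt h => Nat.find_min hex hlt ⟨hl, ?_, ?_⟩, h2, h3⟩
  · exact fun u _ v _ hc => h2.core (h.1.core hc)
  · exact fun u _ v _ hc => h.2.core (h3.core hc)

/-! ## Matching cuts as relations -/

/-- `R` is the relation of the edges of a matching cut. -/
def MatchingCut (I : Inst) (R : ℕ → ℕ → Prop) : Prop :=
  ∃ A : ℕ → Prop, (∃ u < I.n, A u) ∧ (∃ u < I.n, ¬A u) ∧
    (∀ u v, R u v ↔ I.Adj u v ∧ ¬(A u ↔ A v)) ∧ ∀ u v w, R u v → R u w → v = w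

theorem MatchingCut.symm {R : ℕ → ℕ → Prop} (h : I.MatchingCut R) (huv : R u v) : R v u := by
  obtain ⟨A, -, -, hR, -⟩ := h
  rw [hR] at huv ⊢
  exact ⟨huv.1.symm, fun h => huv.2 h.symm⟩

theorem MatchingCut.adj {R : ℕ → ℕ → Prop} (h : I.MatchingCut R) (huv : R u v) : I.Adj u v := by
  obtain ⟨A, -, -, hR, -⟩ := h
  exact ((hR u v).1 huv).1

theorem MatchingCut.eq {R : ℕ → ℕ → Prop} (h : I.MatchingCut R) (huv : R u v) (huw : R u w) :
    v = w := by
  obtain ⟨A, -, -, -, hM⟩ := h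
  exact hM u v w huv huw

/-- The pendant vertices in `S` can be added to the edge cut of the colouring `k`. -/
structure Good (I : Inst) (k : ℕ) (S : ℕ → Prop) : Prop where
  pend : ∀ v, S v → I.Pend v
  not_sat : ∀ v, S v → ¬I.Sat k (I.nb v)
  eq : ∀ v w, S v → S w → I.nb v = I.nb w → v = w

variable {S S' : ℕ → Prop} {R R' : ℕ → ℕ → Prop}

theorem Good.empty : I.Good k (fun _ => False) :=
  ⟨fun _ h => h.elim, fun _ h => h.elim, fun _ _ h => h.elim⟩

/-- Core edges avoid pendant vertices while every selected edge contains one; hence core and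
selection are determined by the output, and monotonically so. -/
theorem Good.core_iff (h : I.Good k S) : I.Core k u v ↔ I.OutRel k S u v ∧ ¬I.Pend u ∧ ¬I.Pend v := by
  constructor
  · exact fun hc => ⟨.inl hc, hc.not_pend_left, hc.not_pend_right⟩
  · rintro ⟨hc | ⟨_, hs | hs⟩, hu, hv⟩
    · exact hc
    · exact (hu (h.pend _ hs)).elim
    · exact (hv (h.pend _ hs)).elim

theorem Good.iff_outRel (h : I.Good k S) : S v ↔ I.Pend v ∧ I.OutRel k S v (I.nb v) := by
  constructor
  · exact fun hs => ⟨h.pend v hs, .inr ⟨(h.pend v hs).adj_nb, .inl hs⟩⟩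
  · rintro ⟨hp, hc | ⟨_, hs | hs⟩⟩
    · exact (hc.not_pend_left hp).elim
    · exact hs
    · exact (hp.not_pend_nb (h.pend _ hs)).elim

theorem Good.eq_nb (h : I.Good k S) (hv : S v) (ha : I.Adj u v) : u = I.nb v :=
  ((h.pend v hv).nb_eq ha.symm).symm

/-- Flipping the selected pendant vertices in the colouring gives a partition with exactly this cut.
If some edge is cut, both sides are inhabited; otherwise `hb` forces the graph to be disconnected
and a different partition witnesses the empty cut. -/
theorem matchingCut_outRel (hk : I.Valid k) (h : I.Good k S) (hb : I.Bad k → ∃ v, S v) :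
    I.MatchingCut (I.OutRel k S) := by
  have hM : ∀ u v w, I.OutRel k S u v → I.OutRel k S u w → v = w := by
    rintro u v w (hv | ⟨av, hv⟩) (hw | ⟨aw, hw⟩)
    · exact hk.eq hv hw
    · rcases hw with hw | hw
      · exact (hv.not_pend_left (h.pend _ hw)).elim
      · exact (h.not_sat w hw (h.eq_nb hw aw ▸ hv.sat)).elim
    · rcases hv with hv | hv
      · exact (hw.not_pend_left (h.pend _ hv)).elim
      · exact (h.not_sat v hv (h.eq_nb hv av ▸ hw.sat)).elim
    · by_cases hu : S u
      · exact (h.pend u hu).unique av aw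
      · replace hv := hv.resolve_left hu
        replace hw := hw.resolve_left hu
        exact h.eq v w hv hw ((h.eq_nb hv av).symm.trans (h.eq_nb hw aw))
  have hR : ∀ u v, I.OutRel k S u v ↔
      I.Adj u v ∧ ¬((I.Col k u ↔ ¬S u) ↔ (I.Col k v ↔ ¬S v)) := by
    intro u v
    constructor
    · intro ho
      have ha : I.Adj u v := by
        rcases ho with hc | hc
        · exact hc.1
        · exact hc.1
      refine ⟨ha, ?_⟩
      rcases ho with hc | ⟨_, hs | hs⟩
      · have h1 : ¬S u := fun hs => hc.not_pend_left (h.pend _ hs)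
        have h2 : ¬S v := fun hs => hc.not_pend_right (h.pend _ hs)
        have := hc.2
        tauto
      · have hp := h.pend _ hs
        have e := hp.nb_eq ha
        have h2 : ¬S v := fun hs' => hp.not_pend_nb (e ▸ h.pend _ hs')
        have := hp.col_iff (k := k)
        rw [e] at this
        tauto
      · have hp := h.pend _ hs
        have e := hp.nb_eq ha.symm
        have h2 : ¬S u := fun hs' => hp.not_pend_nb (e ▸ h.pend _ hs')
        have := hp.col_iff (k := k)
        rw [e] at this
        tauto
    · rintro ⟨ha, hc⟩
      by_cases h1 : S u
      · exact .inr ⟨ha, .inl h1⟩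
      by_cases h2 : S v
      · exact .inr ⟨ha, .inr h2⟩
      · exact .inl ⟨ha, by tauto⟩
  by_cases hne : ∃ u v, I.OutRel k S u v
  · obtain ⟨u, v, huv⟩ := hne
    obtain ⟨ha, hc⟩ := (hR u v).1 huv
    refine ⟨fun v => I.Col k v ↔ ¬S v, ?_, ?_, hR, hM⟩
    · by_cases h1 : I.Col k u ↔ ¬S u
      · exact ⟨u, ha.left_lt, h1⟩
      · exact ⟨v, ha.right_lt, not_not.1 fun h2 => hc (iff_of_false h1 h2)⟩
    · by_cases h1 : I.Col k u ↔ ¬S u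
      · exact ⟨v, ha.right_lt, fun h2 => hc (iff_of_true h1 h2)⟩
      · exact ⟨u, ha.left_lt, h1⟩
  · push Not at hne
    have hS : ∀ v, ¬S v := fun v hv => hne _ _ ((h.iff_outRel.1 hv).2)
    have hE : I.EmptyCore k := fun u _ v _ hc => hne u v (.inl hc)
    have hD : I.Disc := by
      by_contra hD
      obtain ⟨v, hv⟩ := hb ⟨hE, hD⟩
      exact hS v hv
    rcases hD with ⟨hn, u, hu, hiso⟩ | ⟨l, _, hl, ht, hf⟩
    · refine ⟨fun v => v = u, ⟨u, hu, rfl⟩, ?_, fun v w => ?_, hM⟩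
      · by_cases h0 : u = 0
        · exact ⟨1, by omega, by omega⟩
        · exact ⟨0, by omega, by omega⟩
      · simp only [hne, false_iff, not_and, not_not]
        intro ha
        constructor
        · rintro rfl
          exact (hiso w ha.right_lt ha).elim
        · rintro rfl
          exact (hiso v ha.left_lt ha.symm).elim
    · refine ⟨I.Col l, ht, hf, fun v w => ?_, hM⟩
      simp only [hne, false_iff]
      exact hl.not_core

/-- An isolated vertex settles the matter by the first clause of `Disc`, which exists because codes
have no control over such vertices. Without them, the code of the partition reproduces it
everywhere: here even pendant vertices agree with their neighbours. -/
theorem Disc.of_matchingCut (h : I.MatchingCut R) (hR : ∀ u v, ¬R u v) : I.Disc := by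
  obtain ⟨A, ⟨a, ha, hAa⟩, ⟨b, hb, hAb⟩, hA, hM⟩ := h
  have hA' : ∀ u v, I.Adj u v → (A u ↔ A v) := fun u v huv => by
    by_contra h
    exact hR u v ((hA u v).2 ⟨huv, h⟩)
  by_cases hiso : ∃ u < I.n, ∀ v < I.n, ¬I.Adj u v
  · refine .inl ⟨?_, hiso⟩
    have : a ≠ b := by
      rintro rfl
      exact hAb hAa
    omega
  · push Not at hiso
    obtain ⟨k, hk, hcol⟩ := exists_code (I := I) (A := A) fun u v w h h' => (h' (hA' u v h)).elim
    have hcol' : ∀ v < I.n, (I.Col k v ↔ A v) := fun v hv => by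
      by_cases hp : I.Pend v
      · rw [hp.col_iff, hA' v _ hp.adj_nb]
        exact hcol _ hp.not_pend_nb ⟨v, hp.adj_nb.symm⟩
      · obtain ⟨x, -, hx⟩ := hiso v hv
        exact hcol v hp ⟨x, hx⟩
    refine .inr ⟨k, hk, fun u hu v hv hc => hc.2 ?_, ⟨a, ha, (hcol' a ha).2 hAa⟩, b, hb,
      fun h => hAb ((hcol' b hb).1 h)⟩
    rw [hcol' u hu, hcol' v hv]
    exact hA' u v hc.1

/-- The core is the part of `R` that avoids pendant vertices, and `S` consists of the pendant
vertices whose edge lies in `R`. -/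
theorem MatchingCut.exists_outRel (h : I.MatchingCut R) :
    ∃ k < I.codes, I.Valid k ∧ I.First k ∧ ∃ S, I.Good k S ∧ R = I.OutRel k S ∧
      (I.Bad k → ∃ v, S v) := by
  obtain ⟨A, -, -, hA, hM⟩ := id h
  obtain ⟨k₀, hk₀, hcol⟩ := exists_code (I := I) (A := A) fun u v w h1 h2 h3 h4 =>
    hM u v w ((hA u v).2 ⟨h1, h2⟩) ((hA u w).2 ⟨h3, h4⟩)
  obtain ⟨k, hk, hfirst, hs1, hs2⟩ := exists_first hk₀
  have hcore : ∀ u v, I.Core k u v ↔ R u v ∧ ¬I.Pend u ∧ ¬I.Pend v := by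
    intro u v
    constructor
    · intro hc
      have hc₀ := hs1.core hc
      refine ⟨(hA u v).2 ⟨hc.1, ?_⟩, hc.not_pend_left, hc.not_pend_right⟩
      rw [← hcol u hc.not_pend_left ⟨v, hc.1⟩, ← hcol v hc.not_pend_right ⟨u, hc.1.symm⟩]
      exact hc₀.2
    · rintro ⟨hr, hu, hv⟩
      obtain ⟨ha, hc⟩ := (hA u v).1 hr
      refine hs2.core ⟨ha, ?_⟩
      rwa [hcol u hu ⟨v, ha⟩, hcol v hv ⟨u, ha.symm⟩]
  have hgood : I.Good k (fun v => I.Pend v ∧ R v (I.nb v)) := by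
    refine ⟨fun v hv => hv.1, fun v hv hs => ?_, fun v w hv hw hvw => ?_⟩
    · obtain ⟨w, -, hw⟩ := hs
      have := hM _ _ _ ((hcore _ _).1 hw).1 (h.symm hv.2)
      exact hw.not_pend_right (this ▸ hv.1)
    · exact hM _ _ _ (h.symm hv.2) (hvw ▸ h.symm hw.2)
  have hR : R = I.OutRel k (fun v => I.Pend v ∧ R v (I.nb v)) := by
    funext u v
    refine propext ⟨fun hr => ?_, ?_⟩
    · have ha := h.adj hr
      by_cases hu : I.Pend u
      · exact .inr ⟨ha, .inl ⟨hu, by rwa [hu.nb_eq ha]⟩⟩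
      by_cases hv : I.Pend v
      · exact .inr ⟨ha, .inr ⟨hv, by rw [hv.nb_eq ha.symm]; exact h.symm hr⟩⟩
      · exact .inl ((hcore u v).2 ⟨hr, hu, hv⟩)
    · rintro (hc | ⟨ha, hs | hs⟩)
      · exact ((hcore u v).1 hc).1
      · have := hs.2
        rwa [hs.1.nb_eq ha] at this
      · have := hs.2
        rw [hs.1.nb_eq ha.symm] at this
        exact h.symm this
  refine ⟨k, hk, fun u _ v _ w _ hv hw => hM u v w ((hcore _ _).1 hv).1 ((hcore _ _).1 hw).1,
    hfirst, _, hgood, hR, fun hb => ?_⟩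
  by_contra hne
  refine hb.2 (Disc.of_matchingCut h fun u v hr => ?_)
  rw [hR] at hr
  rcases hr with hc | ⟨ha, hs | hs⟩
  · exact hb.1.not_core hc
  · exact hne ⟨_, hs⟩
  · exact hne ⟨_, hs⟩

theorem OutRel.core_of_le (hS : I.Good k S) (hS' : I.Good l S')
    (h : ∀ u v, I.OutRel k S u v → I.OutRel l S' u v) : I.SubCore k l := fun u _ v _ hc => by
  rw [hS.core_iff] at hc
  exact hS'.core_iff.2 ⟨h u v hc.1, hc.2⟩

theorem OutRel.sel_of_le (hS : I.Good k S) (hS' : I.Good l S')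
    (h : ∀ u v, I.OutRel k S u v → I.OutRel l S' u v) (hv : S v) : S' v := by
  rw [hS.iff_outRel] at hv
  exact hS'.iff_outRel.2 ⟨hv.1, h _ _ hv.2⟩

/-- Equal outputs have equal cores, and only one code of a core is first. -/
theorem OutRel.injective (hk : k < I.codes) (hl : l < I.codes) (hk₁ : I.First k) (hl₁ : I.First l)
    (hS : I.Good k S) (hS' : I.Good l S') (h : I.OutRel k S = I.OutRel l S') : k = l ∧ S = S' := by
  have h1 : ∀ u v, I.OutRel k S u v → I.OutRel l S' u v := fun u v huv => h ▸ huv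
  have h2 : ∀ u v, I.OutRel l S' u v → I.OutRel k S u v := fun u v huv => h ▸ huv
  have s1 := OutRel.core_of_le hS hS' h1
  have s2 := OutRel.core_of_le hS' hS h2
  refine ⟨?_, ?_⟩
  · rcases lt_trichotomy k l with h | h | h
    · exact (hl₁ k hk h ⟨s1, s2⟩).elim
    · exact h
    · exact (hk₁ l hl h ⟨s2, s1⟩).elim
  · funext v
    exact propext ⟨OutRel.sel_of_le hS hS' h1, OutRel.sel_of_le hS' hS h2⟩

end Inst

/-! ## Mixed radix representation -/

/-- Reducing `q` modulo a product of more radices does not change its lower digits; this drives both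
inductions on the number of digits. -/
theorem mod_div_mod {q a b c : ℕ} (h : a * b ∣ c) : q % c / a % b = q / a % b := by
  obtain ⟨d, rfl⟩ := h
  rw [mul_assoc, Nat.mod_mul_right_div_self, Nat.mod_mul_right_mod]

theorem prod_range_mul_dvd (r : ℕ → ℕ) {x n : ℕ} (h : x < n) :
    (∏ y ∈ Finset.range x, r y) * r x ∣ ∏ y ∈ Finset.range n, r y := by
  rw [← Finset.prod_range_succ]
  exact Finset.prod_dvd_prod_of_subset _ _ _ (Finset.range_subset_range.2 h)

theorem digits_injective (r : ℕ → ℕ) (hr : ∀ x, 0 < r x) (n : ℕ) : ∀ {q q' : ℕ},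
    q < ∏ y ∈ Finset.range n, r y → q' < ∏ y ∈ Finset.range n, r y →
    (∀ x < n, q / (∏ y ∈ Finset.range x, r y) % r x = q' / (∏ y ∈ Finset.range x, r y) % r x) →
    q = q' := by
  induction n with
  | zero =>
    intro q q' h h' _
    simp at h h'
    omega
  | succ n ih =>
    intro q q' h h' hd
    rw [Finset.prod_range_succ] at h h'
    set P := ∏ y ∈ Finset.range n, r y with hP
    have hPpos : 0 < P := Finset.prod_pos fun y _ => hr y
    have h1 : q % P = q' % P := ih (Nat.mod_lt _ hPpos) (Nat.mod_lt _ hPpos) fun x hx => by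
      rw [mod_div_mod (prod_range_mul_dvd r hx), mod_div_mod (prod_range_mul_dvd r hx)]
      exact hd x (by omega)
    have h2 : q / P = q' / P := by
      have := hd n (by omega)
      rwa [Nat.mod_eq_of_lt (Nat.div_lt_of_lt_mul h), Nat.mod_eq_of_lt (Nat.div_lt_of_lt_mul h')]
        at this
    rw [← Nat.div_add_mod q P, ← Nat.div_add_mod q' P, h1, h2]

theorem digits_surjective (r : ℕ → ℕ) (hr : ∀ x, 0 < r x) (δ : ℕ → ℕ) (n : ℕ)
    (hδ : ∀ x < n, δ x < r x) : ∃ q < ∏ y ∈ Finset.range n, r y,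
      ∀ x < n, q / (∏ y ∈ Finset.range x, r y) % r x = δ x := by
  induction n with
  | zero => exact ⟨0, by simp, by simp⟩
  | succ n ih =>
    obtain ⟨q, hq, hd⟩ := ih fun x hx => hδ x (by omega)
    rw [Finset.prod_range_succ]
    set P := ∏ y ∈ Finset.range n, r y with hP
    have hPpos : 0 < P := Finset.prod_pos fun y _ => hr y
    have hδn := hδ n (by omega)
    refine ⟨q + P * δ n, ?_, fun x hx => ?_⟩
    · have : P * (δ n + 1) ≤ P * r n := Nat.mul_le_mul_left _ hδn
      rw [mul_add] at this
      omega
    · rcases Nat.lt_succ_iff_lt_or_eq.1 hx with hx | rfl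
      · rw [← hd x hx, ← mod_div_mod (prod_range_mul_dvd r hx), ← hP, Nat.add_mul_mod_self_left,
          Nat.mod_eq_of_lt hq]
      · rw [← hP, Nat.add_mul_div_left _ _ hPpos, Nat.div_eq_of_lt hq, zero_add,
          Nat.mod_eq_of_lt hδn]

/-! ### Selections of pendant vertices as digits -/

namespace Inst

variable {I : Inst} {c k l q q' u v w x : ℕ} {S S' : ℕ → Prop} {R R' : ℕ → ℕ → Prop}

theorem radix_pos (c : ℕ) (I : Inst) (k x : ℕ) : 0 < I.radix c k x := by
  rw [radix]
  split_ifs <;> omega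

/-- The number of choices of pendant vertices. -/
noncomputable def choices (c : ℕ) (I : Inst) (k : ℕ) : ℕ := ∏ x ∈ Finset.range I.n, I.radix c k x

/-- The definition of `digit` pads the product with ones up to `n`, since `Feasible.prod` needs a
small limit for every `x`. -/
theorem digit_eq (hx : x < I.n) :
    I.digit c k q x = q / (∏ y ∈ Finset.range x, I.radix c k y) % I.radix c k x := by
  rw [digit, ← Finset.prod_filter]
  congr 3
  ext y
  simp only [Finset.mem_filter, Finset.mem_range]
  omega

theorem digit_lt : I.digit c k q x < I.radix c k x := Nat.mod_lt _ (radix_pos c I k x)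

theorem Pend.rank_lt (h : I.Pend v) : I.pendRank v < I.pendCount (I.nb v) :=
  numLt_lt_numLt (p := fun w => I.Pend w ∧ I.Adj w (I.nb v)) h.lt ⟨h, h.adj_nb⟩

theorem Pend.eq_of_rank (hv : I.Pend v) (hw : I.Pend w) (h : I.nb v = I.nb w)
    (hr : I.pendRank v = I.pendRank w) : v = w := by
  simp only [pendRank, h] at hr
  exact numLt_injective (p := fun u => I.Pend u ∧ I.Adj u (I.nb w)) ⟨hv, h ▸ hv.adj_nb⟩
    ⟨hw, hw.adj_nb⟩ hr

theorem exists_pend_of_lt {j : ℕ} (h : j < I.pendCount x) :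
    ∃ v, I.Pend v ∧ I.nb v = x ∧ I.pendRank v = j := by
  obtain ⟨v, -, ⟨hp, ha⟩, hr⟩ := exists_numLt_eq h
  have := hp.nb_eq ha
  refine ⟨v, hp, this, ?_⟩
  rw [pendRank, this, hr]

theorem good_sel : I.Good k (I.Sel c k q) := by
  refine ⟨fun v h => h.1, fun v h => h.2.1, fun v w hv hw h => hv.1.eq_of_rank hw.1 h ?_⟩
  have h1 := hv.2.2
  have h2 := hw.2.2
  rw [h] at h1
  omega

/-- At an unsaturated vertex the digit `d` stands for the pendant neighbour of rank `d + c - 1`, and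
for no neighbour when `d + c = 0`. So the digit can be recovered from the selected vertex; if there
is none, the radix is one. -/
theorem digit_le_of_sel (hc : c ≤ 1) (h : ∀ v, I.Sel c k q v → I.Sel c k q' v)
    (hd : I.digit c k q x + c ≠ 0) : I.digit c k q x = I.digit c k q' x := by
  have h1 : I.digit c k q x < I.radix c k x := digit_lt
  have h2 : I.digit c k q' x < I.radix c k x := digit_lt
  rw [radix] at h1 h2
  split_ifs at h1 h2 with hs
  · omega
  by_cases hp : I.digit c k q x + c ≤ I.pendCount x
  · obtain ⟨v, hv, hvx, hr⟩ := exists_pend_of_lt (I := I) (x := x) (j := I.digit c k q x + c - 1)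
      (by omega)
    have h3 := (h v ⟨hv, hvx ▸ hs, by rw [hvx]; omega⟩).2.2
    rw [hvx] at h3
    omega
  · omega

theorem sel_injective (hc : c ≤ 1) (hq : q < I.choices c k) (hq' : q' < I.choices c k)
    (h : I.Sel c k q = I.Sel c k q') : q = q' := by
  refine digits_injective _ (radix_pos c I k) I.n hq hq' fun x hx => ?_
  rw [← digit_eq hx, ← digit_eq hx]
  by_cases h1 : I.digit c k q x + c = 0
  · by_cases h2 : I.digit c k q' x + c = 0
    · omega
    · exact (digit_le_of_sel hc (fun v hv => h ▸ hv) h2).symm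
  · exact digit_le_of_sel hc (fun v hv => h ▸ hv) h1

/-- No pendant edge can be added. -/
def Full (I : Inst) (k : ℕ) (S : ℕ → Prop) : Prop :=
  ∀ v, I.Pend v → ¬I.Sat k (I.nb v) → ∃ w, S w ∧ I.nb w = I.nb v

/-- For `c = 1` no digit stands for the empty choice at a vertex with pendant neighbours. -/
theorem full_sel : I.Full k (I.Sel 1 k q) := by
  intro v hv hs
  have h1 : I.digit 1 k q (I.nb v) < I.radix 1 k (I.nb v) := digit_lt
  have h2 := hv.rank_lt
  rw [radix, if_neg hs] at h1
  obtain ⟨w, hw, hwx, hr⟩ := exists_pend_of_lt (I := I) (x := I.nb v) (j := I.digit 1 k q (I.nb v))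
    (by omega)
  exact ⟨w, ⟨hw, hwx ▸ hs, by rw [hwx, hr]⟩, hwx⟩

theorem exists_sel (hc : c ≤ 1) (hS : I.Good k S) (hf : c = 1 → I.Full k S) :
    ∃ q < I.choices c k, I.Sel c k q = S := by
  classical
  have hex : ∀ x, ∃ d, d < I.radix c k x ∧
      ((∃ v, S v ∧ I.nb v = x ∧ d + c = I.pendRank v + 1) ∨
        (d = 0 ∧ ∀ v, S v → I.nb v ≠ x)) := by
    intro x
    by_cases h : ∃ v, S v ∧ I.nb v = x
    · obtain ⟨v, hv, rfl⟩ := h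
      have h1 := (hS.pend v hv).rank_lt
      refine ⟨I.pendRank v + 1 - c, ?_, .inl ⟨v, hv, rfl, by omega⟩⟩
      rw [radix, if_neg (hS.not_sat v hv)]
      omega
    · push Not at h
      exact ⟨0, radix_pos _ _ _ _, .inr ⟨rfl, h⟩⟩
  choose δ hδ hδ' using hex
  obtain ⟨q, hq, hd⟩ := digits_surjective _ (radix_pos c I k) δ I.n fun x _ => hδ x
  refine ⟨q, hq, ?_⟩
  have hdig : ∀ v, I.Pend v → I.digit c k q (I.nb v) = δ (I.nb v) := fun v hv => by
    rw [digit_eq hv.adj_nb.right_lt, hd _ hv.adj_nb.right_lt]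
  funext v
  refine propext ⟨fun h => ?_, fun h => ?_⟩
  · have h1 := h.2.2
    rw [hdig v h.1] at h1
    rcases hδ' (I.nb v) with ⟨w, hw, hwx, hr⟩ | ⟨h0, hn⟩
    · rwa [h.1.eq_of_rank (hS.pend w hw) hwx.symm (by omega)]
    -- A zero digit that selects `v` forces `c = 1`, and then fullness contradicts `hn`.
    · obtain ⟨w, hw, hwx⟩ := hf (by omega) v h.1 h.2.1
      exact (hn w hw hwx).elim
  · refine ⟨hS.pend v h, hS.not_sat v h, ?_⟩
    rw [hdig v (hS.pend v h)]
    rcases hδ' (I.nb v) with ⟨w, hw, hwx, hr⟩ | ⟨_, hn⟩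
    · rwa [hS.eq v w h hw hwx.symm] at hr ⊢
    · exact (hn v h rfl).elim

/-! ## All matching cuts -/

theorem sel_zero : ¬I.Sel 0 k 0 v := fun h => by
  have := h.2.2
  simp [digit] at this

/-- The index `0` is the empty selection. When the core is empty and the graph connected, the shift
by `ind (I.Bad k)` skips exactly this index. -/
theorem matchingCut_iff : I.MatchingCut R ↔ ∃ k < I.codes, (I.Valid k ∧ I.First k) ∧
    ∃ q < I.choices 0 k - ind (I.Bad k), R = I.OutRel k (I.Sel 0 k (q + ind (I.Bad k))) := by
  constructor
  · intro h
    obtain ⟨k, hk, hv, hf, S, hS, rfl, hb⟩ := h.exists_outRel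
    obtain ⟨q, hq, rfl⟩ := exists_sel (c := 0) (by omega) hS (by omega)
    have hq0 : ind (I.Bad k) ≤ q := by
      by_cases hbad : I.Bad k
      · obtain ⟨v, hv⟩ := hb hbad
        rw [ind_of hbad]
        by_contra h0
        obtain rfl : q = 0 := by omega
        exact sel_zero hv
      · simp [ind_of_not hbad]
    exact ⟨k, hk, ⟨hv, hf⟩, q - ind (I.Bad k), by omega, by rw [Nat.sub_add_cancel hq0]⟩
  · rintro ⟨k, hk, ⟨hv, hf⟩, q, hq, rfl⟩
    refine matchingCut_outRel hv good_sel fun hb => ?_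
    by_contra! hne
    rw [ind_of hb] at hq hne
    have : q + 1 = 0 := sel_injective (c := 0) (I := I) (k := k) (by omega) (by omega) (by omega) (by
      funext v
      simp [hne, sel_zero])
    omega

/-! ## Maximal matching cuts -/

theorem pendCount_eq_zero : I.pendCount x = 0 ↔ ∀ v, I.Pend v → I.nb v ≠ x := by
  constructor
  · rintro h v hv rfl
    have := hv.rank_lt
    omega
  · intro h
    exact numLt_eq_zero fun v _ hv => h v hv.1 (hv.1.nb_eq hv.2)

/-- A maximal cut uses a pendant edge at each unsaturated vertex that has one. A larger cut must
keep these edges, so its core can reach new vertices only where there is no pendant neighbour, as in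
`Extends`. For a bad code the full selection is nonempty exactly when a pendant vertex exists. -/
theorem maximal_iff : Maximal I.MatchingCut R ↔ ∃ k < I.codes,
    (I.Valid k ∧ I.First k ∧ ¬I.Extends k ∧ (I.Bad k → ∃ v < I.n, I.Pend v)) ∧
    ∃ q < I.choices 1 k, R = I.OutRel k (I.Sel 1 k q) := by
  constructor
  · rintro ⟨h, hmax⟩
    obtain ⟨k, hk, hv, hf, S, hS, rfl, hb⟩ := h.exists_outRel
    have hfull : I.Full k S := by
      intro v hpv hs
      by_contra! hne
      have hS' : I.Good k (fun w => S w ∨ w = v) := by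
        refine ⟨?_, ?_, ?_⟩
        · rintro w (hw | rfl)
          exacts [hS.pend w hw, hpv]
        · rintro w (hw | rfl)
          exacts [hS.not_sat w hw, hs]
        · rintro w z (hw | rfl) (hz | rfl) hwz
          · exact hS.eq w z hw hz hwz
          · exact (hne w hw hwz).elim
          · exact (hne z hz hwz.symm).elim
          · rfl
      have hle : I.OutRel k S ≤ I.OutRel k (fun w => S w ∨ w = v) := by
        rintro a b (hc | ⟨ha, hs | hs⟩)
        exacts [.inl hc, .inr ⟨ha, .inl (.inl hs)⟩, .inr ⟨ha, .inr (.inl hs)⟩]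
      have := hmax (matchingCut_outRel hv hS' fun _ => ⟨v, .inr rfl⟩) hle
      exact hne v (OutRel.sel_of_le hS' hS this (.inr rfl)) rfl
    obtain ⟨q, hq, rfl⟩ := exists_sel (c := 1) le_rfl hS fun _ => hfull
    refine ⟨k, hk, ⟨hv, hf, ?_, fun hbad => ?_⟩, q, hq, rfl⟩
    · rintro ⟨l, hl, hvl, h1, h2, h3⟩
      have hSl : I.Good l (I.Sel 1 k q) := by
        refine ⟨hS.pend, fun v hv hs => ?_, hS.eq⟩
        rcases h3 _ (hv.1.adj_nb.right_lt) hs with h | h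
        · exact hS.not_sat v hv h
        · exact pendCount_eq_zero.1 h v hv.1 rfl
      have hle : I.OutRel k (I.Sel 1 k q) ≤ I.OutRel l (I.Sel 1 k q) := by
        rintro a b (hc | h)
        exacts [.inl (h1.core hc), .inr h]
      -- The core of `l` is not contained in that of `k`, hence is not empty, and `l` is not bad.
      have hbl : I.Bad l → ∃ v, I.Sel 1 k q v := fun hb' => by
        refine (h2 fun u _ v _ hc => (hb'.1.not_core hc).elim).elim
      exact h2 (OutRel.core_of_le hSl hS (hmax (matchingCut_outRel hvl hSl hbl) hle))
    · obtain ⟨v, hv⟩ := hb hbad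
      exact ⟨v, hv.1.lt, hv.1⟩
  · rintro ⟨k, hk, ⟨hv, hf, hext, hbad⟩, q, hq, rfl⟩
    refine ⟨matchingCut_outRel hv good_sel fun hb => ?_, fun R' hR' hle => ?_⟩
    · obtain ⟨v, -, hv⟩ := hbad hb
      obtain ⟨w, hw, -⟩ := full_sel (q := q) v hv fun ⟨x, _, hx⟩ => hb.1.not_core hx
      exact ⟨w, hw⟩
    · obtain ⟨l, hl, hvl, -, S, hS, rfl, -⟩ := hR'.exists_outRel
      have h1 : I.SubCore k l := OutRel.core_of_le good_sel hS hle
      have h2 : ∀ v, I.Sel 1 k q v → S v := fun v => OutRel.sel_of_le good_sel hS hle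
      have h3 : I.SubCore l k := by
        by_contra h3
        refine hext ⟨l, hl, hvl, h1, h3, fun x hx hs => ?_⟩
        by_contra! hne
        obtain ⟨v, hv, rfl⟩ : ∃ v, I.Pend v ∧ I.nb v = x := by
          by_contra! h
          exact hne.2 (pendCount_eq_zero.2 h)
        obtain ⟨w, hw, hwv⟩ := full_sel (q := q) v hv hne.1
        exact hS.not_sat w (h2 w hw) (hwv ▸ hs)
      rintro a b (hc | ⟨ha, hs⟩)
      · exact .inl (h3.core hc)
      · have h4 : ∀ v, S v → I.Sel 1 k q v := fun v hv => by
          obtain ⟨w, hw, hwv⟩ := full_sel (q := q) v (hS.pend v hv)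
            fun ⟨x, hx, hc⟩ => hS.not_sat v hv ⟨x, hx, h1.core hc⟩
          rwa [← hS.eq w v (h2 w hw) hv hwv]
        exact .inr ⟨ha, hs.imp (h4 a) (h4 b)⟩

/-! ## Minimal matching cuts -/

/-- The selection of the single pendant vertex number `q`, when the edge cut of the colouring is empty
but no matching cut. -/
def Single (I : Inst) (k q v : ℕ) : Prop := I.Bad k ∧ I.Pend v ∧ numLt I.Pend v = q

theorem good_single : I.Good k (I.Single k q) := by
  refine ⟨fun v h => h.2.1, fun v h ⟨w, _, hw⟩ => h.1.1.not_core hw, fun v w hv hw _ => ?_⟩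
  exact numLt_injective hv.2.1 hw.2.1 (hv.2.2.trans hw.2.2.symm)

/-- Code `0` gives every vertex the second colour; it serves as a base for the empty cut and for
single pendant edges. -/
theorem emptyCore_zero : I.EmptyCore 0 := by
  have h1 : ∀ v, ¬I.CoverCol 0 v := fun v h => by simp [CoverCol, Bit] at h
  have h2 : ∀ v, I.ones 0 v = 0 := fun v => numLt_eq_zero fun x _ hx => h1 x hx.2.2
  have h3 : ∀ v, ¬I.Col 0 v := fun v h => by
    rcases h with ⟨_, h⟩ | ⟨_, h | ⟨h, _⟩⟩
    · exact h1 v h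
    · rw [h2] at h
      omega
    · exact h.2.2 (h2 v)
  intro u _ v _ h
  exact h.2 (by simp [h3])

theorem EmptyCore.valid (h : I.EmptyCore k) : I.Valid k :=
  fun _ _ _ _ _ _ hc => (h.not_core hc).elim

theorem EmptyCore.good (h : I.EmptyCore k) (hv : I.Pend v) : I.Good k (fun w => w = v) := by
  refine ⟨?_, ?_, ?_⟩
  · rintro w rfl
    exact hv
  · rintro w rfl ⟨x, _, hx⟩
    exact h.not_core hx
  · rintro w z rfl rfl _
    rfl

/-- A minimal cut with a pendant edge equals that edge, and any other one is a bare core. If the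
graph is disconnected, only the empty cut is minimal. If it is connected, a nonempty core is minimal
when no nonempty core lies properly inside it. For a bad code `q` numbers the pendant vertices;
otherwise `q = 0` is the only index. -/
theorem minimal_iff : Minimal I.MatchingCut R ↔ ∃ k < I.codes,
    (I.Valid k ∧ I.First k ∧ (I.EmptyCore k ∨ ¬I.Disc ∧ ¬I.Shrinks k)) ∧
    ∃ q < (open Classical in if I.Bad k then numLt I.Pend I.n else 1),
      R = I.OutRel k (I.Single k q) := by
  classical
  constructor
  · rintro ⟨h, hmin⟩
    obtain ⟨k, hk, hv, hf, S, hS, rfl, hb⟩ := h.exists_outRel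
    by_cases hsel : ∃ v, S v
    · -- a single pendant edge
      obtain ⟨v, hsv⟩ := hsel
      have hpv := hS.pend v hsv
      have hle : ∀ l, I.EmptyCore l → I.OutRel l (fun w => w = v) ≤ I.OutRel k S := by
        rintro l hl a b (hc | ⟨ha, rfl | rfl⟩)
        exacts [(hl.not_core hc).elim, .inr ⟨ha, .inl hsv⟩, .inr ⟨ha, .inr hsv⟩]
      have hg := (emptyCore_zero (I := I)).good hpv
      have hge := hmin (matchingCut_outRel emptyCore_zero.valid hg fun _ => ⟨v, rfl⟩)
        (hle 0 emptyCore_zero)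
      have hE : I.EmptyCore k := fun a _ b _ hc =>
        emptyCore_zero.not_core ((OutRel.core_of_le hS hg hge).core hc)
      have hD : ¬I.Disc := fun hD => by
        have h0 := hmin (matchingCut_outRel (S := fun _ => False) hE.valid Good.empty
          fun hb' => (hb'.2 hD).elim) (by
            rintro a b (hc | ⟨_, h | h⟩)
            exacts [.inl hc, h.elim, h.elim])
        exact OutRel.sel_of_le hS Good.empty h0 hsv
      have hbad : I.Bad k := ⟨hE, hD⟩
      have hSv : S = I.Single k (numLt I.Pend v) := by
        funext w
        refine propext ⟨fun hw => ?_, fun hw => ?_⟩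
        · obtain rfl : w = v := OutRel.sel_of_le (S' := fun w => w = v) hS hg hge hw
          exact ⟨hbad, hpv, rfl⟩
        · rwa [numLt_injective hw.2.1 hpv hw.2.2]
      refine ⟨k, hk, ⟨hv, hf, .inl hE⟩, numLt I.Pend v, ?_, by rw [← hSv]⟩
      rw [if_pos hbad]
      exact numLt_lt_numLt hpv.lt hpv
    · have hbad : ¬I.Bad k := fun h => hsel (hb h)
      have hSe : S = I.Single k 0 := by
        push Not at hsel
        funext w
        exact propext ⟨fun hw => (hsel w hw).elim, fun hw => (hbad hw.1).elim⟩
      refine ⟨k, hk, ⟨hv, hf, ?_⟩, 0, by rw [if_neg hbad]; omega, by rw [← hSe]⟩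
      by_cases hE : I.EmptyCore k
      · exact .inl hE
      refine .inr ⟨fun hD => hE ?_, ?_⟩
      · have h0 := hmin (matchingCut_outRel (S := fun _ => False) emptyCore_zero.valid Good.empty
          fun hb' => (hb'.2 hD).elim) (by
            rintro a b (hc | ⟨_, h | h⟩)
            exacts [(emptyCore_zero.not_core hc).elim, h.elim, h.elim])
        exact fun a _ b _ hc => emptyCore_zero.not_core ((OutRel.core_of_le hS Good.empty h0).core hc)
      · rintro ⟨l, hl, hvl, h1, h2, h3⟩
        have h0 := hmin (matchingCut_outRel (S := fun _ => False) hvl Good.empty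
          fun hb' => (h3 hb'.1).elim) (by
            rintro a b (hc | ⟨_, h | h⟩)
            exacts [.inl (h1.core hc), h.elim, h.elim])
        exact h2 (OutRel.core_of_le hS Good.empty h0)
  · rintro ⟨k, hk, ⟨hv, hf, hor⟩, q, hq, rfl⟩
    by_cases hbad : I.Bad k
    · rw [if_pos hbad] at hq
      obtain ⟨v, -, hp, rfl⟩ := exists_numLt_eq hq
      refine ⟨matchingCut_outRel hv good_single fun _ => ⟨v, hbad, hp, rfl⟩, fun R' hR' hle => ?_⟩
      have hne : ∃ a b, R' a b := by
        by_contra! hne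
        exact hbad.2 (Disc.of_matchingCut hR' hne)
      have hedge : ∀ a b, I.OutRel k (I.Single k (numLt I.Pend v)) a b →
          (a = v ∧ b = I.nb v) ∨ (a = I.nb v ∧ b = v) := by
        rintro a b (hc | ⟨ha, hs | hs⟩)
        · exact (hbad.1.not_core hc).elim
        · obtain rfl := numLt_injective hs.2.1 hp hs.2.2
          exact .inl ⟨rfl, (hp.nb_eq ha).symm⟩
        · obtain rfl := numLt_injective hs.2.1 hp hs.2.2
          exact .inr ⟨(hp.nb_eq ha.symm).symm, rfl⟩
      have hR'v : R' v (I.nb v) := by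
        obtain ⟨a, b, hab⟩ := hne
        rcases hedge a b (hle a b hab) with ⟨rfl, rfl⟩ | ⟨rfl, rfl⟩
        · exact hab
        · exact hR'.symm hab
      intro a b hab
      rcases hedge a b hab with ⟨rfl, rfl⟩ | ⟨rfl, rfl⟩
      · exact hR'v
      · exact hR'.symm hR'v
    · refine ⟨matchingCut_outRel hv good_single fun hb => (hbad hb).elim, fun R' hR' hle => ?_⟩
      have hout : ∀ a b, I.OutRel k (I.Single k q) a b → I.Core k a b := by
        rintro a b (hc | ⟨_, hs | hs⟩)
        exacts [hc, (hbad hs.1).elim, (hbad hs.1).elim]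
      rcases hor with hE | ⟨hD, hsh⟩
      · intro a b hab
        exact (hE.not_core (hout a b hab)).elim
      · obtain ⟨l, hl, hvl, -, S, hS, rfl, -⟩ := (id hR').exists_outRel
        have h1 : I.SubCore l k := OutRel.core_of_le hS good_single hle
        have h2 : ∀ v, ¬S v := fun v hv =>
          hbad (OutRel.sel_of_le hS good_single hle hv).1
        have h3 : ¬I.EmptyCore l := fun hE => hD (Disc.of_matchingCut hR' (by
          rintro a b (hc | ⟨_, hs | hs⟩)
          exacts [hE.not_core hc, h2 _ hs, h2 _ hs]))
        have h4 : I.SubCore k l := by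
          by_contra h4
          exact hsh ⟨l, hl, hvl, h1, h4, h3⟩
        exact fun a b hab => .inl (h4.core (hout a b hab))

end Inst

namespace Inst

variable {I : Inst} {R R' : ℕ → ℕ → Prop}

/-! ## Relations and edge sets -/

/-- The set of edges of a relation. -/
def edges (I : Inst) (R : ℕ → ℕ → Prop) : Set (Sym2 (Fin I.n)) :=
  {e | ∃ u v : Fin I.n, R u v ∧ e = s(u, v)}

theorem mem_edges (h : I.MatchingCut R) (u v : Fin I.n) : s(u, v) ∈ I.edges R ↔ R u v := by
  constructor
  · rintro ⟨a, b, hab, he⟩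
    rw [Sym2.eq_iff] at he
    rcases he with ⟨rfl, rfl⟩ | ⟨rfl, rfl⟩
    · exact hab
    · exact h.symm hab
  · exact fun huv => ⟨u, v, huv, rfl⟩

/-- Inclusion is preserved in both directions, so minimality and maximality carry over from
relations to edge sets. -/
theorem edges_subset_iff (h : I.MatchingCut R) (h' : I.MatchingCut R') :
    I.edges R ⊆ I.edges R' ↔ R ≤ R' := by
  constructor
  · intro hs u v huv
    have ha := h.adj huv
    exact (mem_edges h' ⟨u, ha.left_lt⟩ ⟨v, ha.right_lt⟩).1
      (hs ((mem_edges h ⟨u, ha.left_lt⟩ ⟨v, ha.right_lt⟩).2 huv))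
  · rintro hle e ⟨u, v, huv, rfl⟩
    exact ⟨u, v, hle _ _ huv, rfl⟩

theorem isMatchingCut_iff {M : Set (Sym2 (Fin I.n))} :
    I.G.IsMatchingCut M ↔ ∃ R, I.MatchingCut R ∧ M = I.edges R := by
  constructor
  · rintro ⟨⟨A, ⟨a, ha⟩, ⟨b, hb⟩, rfl⟩, hM⟩
    let A' : ℕ → Prop := fun u => ∃ h : u < I.n, (⟨u, h⟩ : Fin I.n) ∈ A
    have hA' : ∀ u : Fin I.n, A' u ↔ u ∈ A := fun u => ⟨fun ⟨_, h⟩ => h, fun h => ⟨u.2, h⟩⟩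
    have hcut : ∀ u v : Fin I.n, s(u, v) ∈ I.G.edgesBetween A Aᶜ ↔
        I.G.Adj u v ∧ ¬(A' u ↔ A' v) := by
      intro u v
      rw [hA', hA']
      constructor
      · rintro ⟨x, hx, y, hy, hxy, he⟩
        rw [Sym2.eq_iff] at he
        have hy' : y ∉ A := hy
        rcases he with ⟨rfl, rfl⟩ | ⟨rfl, rfl⟩
        · exact ⟨hxy, by tauto⟩
        · exact ⟨hxy.symm, by tauto⟩
      · rintro ⟨huv, hc⟩
        by_cases hu : u ∈ A
        · exact ⟨u, hu, v, fun hv => hc (iff_of_true hu hv), huv, rfl⟩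
        · exact ⟨v, not_not.1 fun hv => hc (iff_of_false hu hv), u, hu, huv.symm, Sym2.eq_swap⟩
    refine ⟨fun u v => I.Adj u v ∧ ¬(A' u ↔ A' v), ⟨A', ⟨a, a.2, (hA' a).2 ha⟩,
      ⟨b, b.2, fun h => hb ((hA' b).1 h)⟩, fun _ _ => Iff.rfl, ?_⟩, ?_⟩
    · rintro u v w ⟨⟨hu, hv, huv⟩, h1⟩ ⟨⟨_, hw, huw⟩, h2⟩
      have := hM _ ((hcut ⟨u, hu⟩ ⟨v, hv⟩).2 ⟨huv, h1⟩) _ ((hcut ⟨u, hu⟩ ⟨w, hw⟩).2 ⟨huw, h2⟩) ⟨u, hu⟩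
        (Sym2.mem_mk_left _ _) (Sym2.mem_mk_left _ _)
      rw [Sym2.eq_iff] at this
      simp only [Fin.mk.injEq] at this
      omega
    · ext e
      induction e with
      | _ u v =>
        rw [hcut]
        constructor
        · exact fun ⟨h1, h2⟩ => ⟨u, v, ⟨⟨u.2, v.2, h1⟩, h2⟩, rfl⟩
        · rintro ⟨x, y, ⟨⟨_, _, h1⟩, h2⟩, he⟩
          rw [Sym2.eq_iff] at he
          rcases he with ⟨rfl, rfl⟩ | ⟨rfl, rfl⟩
          · exact ⟨h1, h2⟩
          · exact ⟨h1.symm, fun h => h2 h.symm⟩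
  · rintro ⟨R, hR, rfl⟩
    obtain ⟨A, ⟨a, ha, hAa⟩, ⟨b, hb, hAb⟩, hA, hM⟩ := id hR
    refine ⟨⟨{u | A u}, ⟨⟨a, ha⟩, hAa⟩, ⟨⟨b, hb⟩, hAb⟩, ?_⟩, ?_⟩
    · ext e
      constructor
      · rintro ⟨u, v, huv, rfl⟩
        obtain ⟨⟨_, _, h1⟩, h2⟩ := (hA u v).1 huv
        by_cases hu : A u
        · exact ⟨u, hu, v, fun hv => h2 (iff_of_true hu hv), h1, rfl⟩
        · exact ⟨v, not_not.1 fun hv => h2 (iff_of_false hu hv), u, hu, h1.symm, Sym2.eq_swap⟩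
      · rintro ⟨u, hu, v, hv, huv, rfl⟩
        exact ⟨u, v, (hA u v).2 ⟨⟨u.2, v.2, huv⟩, fun h => hv (h.1 hu)⟩, rfl⟩
    · intro e he f hf v hve hvf
      obtain ⟨x, rfl⟩ := Sym2.mem_iff_exists.1 hve
      obtain ⟨y, rfl⟩ := Sym2.mem_iff_exists.1 hvf
      rw [mem_edges hR] at he hf
      rw [Fin.ext (hM v x y he hf)]

theorem minimal_isMatchingCut_iff {M : Set (Sym2 (Fin I.n))} :
    Minimal I.G.IsMatchingCut M ↔ ∃ R, Minimal I.MatchingCut R ∧ M = I.edges R := by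
  constructor
  · rintro ⟨h, hmin⟩
    obtain ⟨R, hR, rfl⟩ := isMatchingCut_iff.1 h
    refine ⟨R, ⟨hR, fun R' hR' hle => ?_⟩, rfl⟩
    exact (edges_subset_iff hR hR').1 (hmin (isMatchingCut_iff.2 ⟨R', hR', rfl⟩)
      ((edges_subset_iff hR' hR).2 hle))
  · rintro ⟨R, ⟨hR, hmin⟩, rfl⟩
    refine ⟨isMatchingCut_iff.2 ⟨R, hR, rfl⟩, fun M' hM' hle => ?_⟩
    obtain ⟨R', hR', rfl⟩ := isMatchingCut_iff.1 hM'
    exact (edges_subset_iff hR hR').2 (hmin hR' ((edges_subset_iff hR' hR).1 hle))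

theorem maximal_isMatchingCut_iff {M : Set (Sym2 (Fin I.n))} :
    Maximal I.G.IsMatchingCut M ↔ ∃ R, Maximal I.MatchingCut R ∧ M = I.edges R := by
  constructor
  · rintro ⟨h, hmax⟩
    obtain ⟨R, hR, rfl⟩ := isMatchingCut_iff.1 h
    refine ⟨R, ⟨hR, fun R' hR' hle => ?_⟩, rfl⟩
    exact (edges_subset_iff hR' hR).1 (hmax (isMatchingCut_iff.2 ⟨R', hR', rfl⟩)
      ((edges_subset_iff hR hR').2 hle))
  · rintro ⟨R, ⟨hR, hmax⟩, rfl⟩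
    refine ⟨isMatchingCut_iff.2 ⟨R, hR, rfl⟩, fun M' hM' hle => ?_⟩
    obtain ⟨R', hR', rfl⟩ := isMatchingCut_iff.1 hM'
    exact (edges_subset_iff hR' hR).2 (hmax hR' ((edges_subset_iff hR hR').1 hle))

end Inst

/-! ## Correctness of the scheme -/

/-- The relation is symmetric, and the condition `u < v` picks one orientation of each edge. -/
theorem listsEdges_relWord {I : Inst} {R : Inst → ℕ → ℕ → ℕ → ℕ → Prop} {k q : ℕ}
    {Q : ℕ → ℕ → Prop} (hQ : I.MatchingCut Q) (hR : ∀ u v, R I k q u v ↔ u < v ∧ Q u v) :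
    ListsEdges (relWord R I k q I.n) (I.edges Q) := by
  classical
  let pairs : List (Fin I.n × Fin I.n) := (List.finRange I.n).flatMap fun u : Fin I.n =>
    ((List.finRange I.n).filter fun v : Fin I.n => decide (R I k q u v)).map fun v => (u, v)
  have hmem : ∀ p, p ∈ pairs ↔ R I k q p.1 p.2 := by
    rintro ⟨u, v⟩
    simp [pairs]
  have hnodup : pairs.Nodup := by
    rw [List.nodup_flatMap]
    refine ⟨fun u _ => ((List.nodup_finRange _).filter _).map fun _ _ h => (Prod.mk.inj h).2, ?_⟩
    refine (List.nodup_finRange I.n).pairwise_of_forall_ne fun u _ v _ huv => ?_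
    intro p h1 h2
    simp only [List.mem_map] at h1 h2
    obtain ⟨_, _, rfl⟩ := h1
    obtain ⟨_, _, h⟩ := h2
    exact huv (Prod.mk.inj h).1.symm
  refine ⟨pairs, ?_, ?_, ?_⟩
  · have hrange : List.range I.n = (List.finRange I.n).map Fin.val :=
      (List.map_coe_finRange_eq_range).symm
    simp only [pairs, relWord, rowWord, hrange, List.flatMap_assoc, List.flatMap_map]
    congr 1
    funext u
    induction List.finRange I.n with
    | nil => rfl
    | cons v l ih =>
      by_cases h : R I k q u v
      · simp [h, ih]
      · simp [h, ih]
  · refine hnodup.map_on fun p hp p' hp' h => ?_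
    rw [hmem, hR] at hp hp'
    rw [Sym2.eq_iff] at h
    rcases h with ⟨h1, h2⟩ | ⟨h1, h2⟩
    · exact Prod.ext h1 h2
    · rw [h1, h2] at hp
      omega
  · ext e
    simp only [Set.mem_ofPred_eq, List.mem_map, hmem, hR]
    constructor
    · rintro ⟨u, v, huv, rfl⟩
      rcases lt_or_gt_of_ne (hQ.adj huv).ne with h | h
      · exact ⟨(u, v), ⟨h, huv⟩, rfl⟩
      · exact ⟨(v, u), ⟨h, hQ.symm huv⟩, Sym2.eq_swap⟩
    · rintro ⟨⟨u, v⟩, ⟨_, h⟩, rfl⟩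
      exact ⟨u, v, h, rfl⟩

theorem mem_indexList {T : Inst → ℕ → Prop} {N : Inst → ℕ → ℕ} {I : Inst} {m : ℕ} {p : ℕ × ℕ} :
    p ∈ indexList T N I m ↔ p.1 < m ∧ T I p.1 ∧ p.2 < N I p.1 := by
  obtain ⟨k, q⟩ := p
  simp only [indexList, List.mem_flatMap, List.mem_range]
  constructor
  · rintro ⟨l, hl, h⟩
    split_ifs at h with hT
    · simp only [List.mem_map, List.mem_range, Prod.mk.injEq] at h
      obtain ⟨_, hq, rfl, rfl⟩ := h
      exact ⟨hl, hT, hq⟩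
    · simp at h
  · rintro ⟨hk, hT, hq⟩
    exact ⟨k, hk, by simpa [hT] using hq⟩

theorem nodup_indexList {T : Inst → ℕ → Prop} {N : Inst → ℕ → ℕ} {I : Inst} {m : ℕ} :
    (indexList T N I m).Nodup := by
  rw [indexList, List.nodup_flatMap]
  refine ⟨fun k _ => ?_, (List.nodup_range).pairwise_of_forall_ne fun k _ l _ hkl => ?_⟩
  · split_ifs
    · exact List.nodup_range.map fun _ _ h => (Prod.mk.inj h).2
    · exact List.nodup_nil
  · intro p h1 h2
    beta_reduce at h1 h2
    split_ifs at h1 h2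
    · simp only [List.mem_map] at h1 h2
      obtain ⟨_, _, rfl⟩ := h1
      obtain ⟨_, _, h⟩ := h2
      exact hkl (Prod.mk.inj h).1.symm
    all_goals simp at h1 h2

theorem length_indexList_le {T : Inst → ℕ → Prop} {N : Inst → ℕ → ℕ} {I : Inst} {m b : ℕ}
    (hb : ∀ k < m, N I k ≤ b) : (indexList T N I m).length ≤ m * b := by
  rw [indexList, List.length_flatMap]
  refine (List.sum_le_card_nsmul _ b ?_).trans (by simp)
  simp only [List.mem_map, List.mem_range]
  rintro _ ⟨k, hk, rfl⟩
  split_ifs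
  · simpa using hb k hk
  · simp

/-- If the matching cuts in the family `F` are given by indices, they can be enumerated. -/
theorem exists_enumeration {T : Inst → ℕ → Prop} {N : Inst → ℕ → ℕ} {S : Inst → ℕ → ℕ → ℕ → Prop}
    (hT : Decides₁ T) (hN : Feasible₁ N) (hS : Decides₃ S)
    (F : Inst → (ℕ → ℕ → Prop) → Prop) (hF : ∀ (I : Inst) R, F I R → I.MatchingCut R)
    (hiff : ∀ (I : Inst) R, F I R ↔ ∃ k < I.codes, T I k ∧ ∃ q < N I k, R = I.OutRel k (S I k q))
    (hfirst : ∀ (I : Inst) k, T I k → I.First k) (hgood : ∀ (I : Inst) k q, I.Good k (S I k q))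
    (hinj : ∀ (I : Inst) k q q', T I k → q < N I k → q' < N I k → S I k q = S I k q' → q = q') :
    ∃ (P : Cmd) (D : ℕ → ℕ), PolyBounded D ∧ ∀ I : Inst, ∃ ts t,
      Enumerates P I.G {M | ∃ R, F I R ∧ M = I.edges R} ts t ∧
      List.IsChain (fun s t => t ≤ s + D I.scale) (0 :: (ts ++ [t])) ∧
      ts.length = (indexList T N I I.codes).length := by
  obtain ⟨P, D, hD, h⟩ := exists_scheme Inst.codes T N
    (fun I k q u v => u < v ∧ I.OutRel k (S I k q) u v) Inst.feasible_codes Inst.small_codes hT hN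
    (Inst.decides_outRel hS)
  refine ⟨P, D, hD, fun I => ?_⟩
  obtain ⟨σ, hr, ho, hc⟩ := h I
  have hmc : ∀ p ∈ indexList T N I I.codes, F I (I.OutRel p.1 (S I p.1 p.2)) := fun p hp => by
    obtain ⟨h1, h2, h3⟩ := mem_indexList.1 hp
    exact (hiff I _).2 ⟨p.1, h1, h2, p.2, h3, rfl⟩
  refine ⟨_, _, ⟨σ, hr, rfl, rfl, (indexList T N I I.codes).map fun p =>
    I.edges (I.OutRel p.1 (S I p.1 p.2)), ?_, ?_, ?_⟩, hc, ?_⟩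
  · refine nodup_indexList.map_on fun p hp p' hp' he => ?_
    have hm := hF I _ (hmc p hp)
    have hm' := hF I _ (hmc p' hp')
    obtain ⟨h1, h2, h3⟩ := mem_indexList.1 hp
    obtain ⟨h1', h2', h3'⟩ := mem_indexList.1 hp'
    obtain ⟨hk, hSS⟩ := Inst.OutRel.injective h1 h1' (hfirst I _ h2) (hfirst I _ h2') (hgood I _ _)
      (hgood I _ _) (le_antisymm ((Inst.edges_subset_iff hm hm').1 he.le)
        ((Inst.edges_subset_iff hm' hm).1 he.ge))
    obtain ⟨k, q⟩ := p
    obtain ⟨k', q'⟩ := p'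
    obtain rfl : k = k' := hk
    rw [hinj I k q q' h2 h3 h3' hSS]
  · intro M
    simp only [List.mem_map, Set.mem_ofPred_eq]
    constructor
    · rintro ⟨p, hp, rfl⟩
      exact ⟨_, hmc p hp, rfl⟩
    · rintro ⟨R, hR, rfl⟩
      obtain ⟨k, hk, hTk, q, hq, rfl⟩ := (hiff I R).1 hR
      exact ⟨(k, q), mem_indexList.2 ⟨hk, hTk, hq⟩, rfl⟩
  · rw [ho, List.forall₂_map_left_iff, List.forall₂_map_right_iff, List.forall₂_same]
    exact fun p hp => listsEdges_relWord (hF I _ (hmc p hp)) fun _ _ => Iff.rfl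
  · have := congrArg List.length ho
    simpa using this

/-! ### From delays to the three parameterised bounds -/

theorem le_of_isChain {D t : ℕ} : ∀ {s : ℕ} {ts : List ℕ},
    List.IsChain (fun a b => b ≤ a + D) (s :: (ts ++ [t])) → t ≤ s + (ts.length + 1) * D
  | s, [], h => by simpa using h
  | s, a :: ts, h => by
    rw [List.cons_append, List.isChain_cons_cons] at h
    have h1 := le_of_isChain h.2
    have h2 := h.1
    rw [List.length_cons, add_mul _ 1 D]
    omega

/-- Since `2 ^ (4τ) ≥ 1`, the sum `n + 2 ^ (4τ) + 2` is at most the product `2 ^ (4τ) * (n + 3)`,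
and powers of a product split. -/
theorem exists_fpt_bound {D : ℕ → ℕ} (hD : PolyBounded D) : ∃ (c : ℕ) (p : Polynomial ℕ),
    ∀ I : Inst, D I.scale ≤ 2 ^ (c * I.G.vertexCoverNum.toNat) * p.eval I.n := by
  obtain ⟨C, hC⟩ := hD
  refine ⟨4 * C, (Polynomial.X + 3) ^ C, fun I => (hC _).trans ?_⟩
  have h : I.scale + 2 ≤ 2 ^ (4 * I.G.vertexCoverNum.toNat) * (I.n + 3) := by
    have h1 : 1 ≤ 2 ^ (4 * I.G.vertexCoverNum.toNat) := Nat.one_le_two_pow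
    rw [Inst.scale]
    nlinarith
  refine (Nat.pow_le_pow_left h C).trans ?_
  rw [mul_pow, ← pow_mul]
  simp only [Polynomial.eval_pow, Polynomial.eval_add, Polynomial.eval_X, Polynomial.eval_ofNat]
  rw [mul_right_comm]

theorem exists_delay {P : Cmd} {D : ℕ → ℕ} (hD : PolyBounded D)
    {F : ∀ I : Inst, Set (Set (Sym2 (Fin I.n)))}
    (h : ∀ I : Inst, ∃ ts t, Enumerates P I.G (F I) ts t ∧
      List.IsChain (fun s t => t ≤ s + D I.scale) (0 :: (ts ++ [t]))) :
    ∃ (P : RAM.Cmd) (c : ℕ) (p : Polynomial ℕ), ∀ (n : ℕ) (G : SimpleGraph (Fin n)),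
      RAM.EnumeratesWithDelay P G (F ⟨n, G⟩)
        (2 ^ (c * G.vertexCoverNum.toNat) * p.eval n) := by
  obtain ⟨c, p, hcp⟩ := exists_fpt_bound hD
  refine ⟨P, c, p, fun n G => ?_⟩
  obtain ⟨ts, t, he, hc⟩ := h ⟨n, G⟩
  exact ⟨ts, t, he, hc.imp fun a b hab => hab.trans (Nat.add_le_add_left (hcp ⟨n, G⟩) a)⟩

theorem exists_minimal_enumeration :
    ∃ (P : RAM.Cmd) (c : ℕ) (p : Polynomial ℕ), ∀ (n : ℕ) (G : SimpleGraph (Fin n)),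
      RAM.EnumeratesInTime P G {M | Minimal G.IsMatchingCut M}
        (2 ^ (c * G.vertexCoverNum.toNat) * p.eval n) := by
  classical
  obtain ⟨P, D, hD, h⟩ := exists_enumeration
    (T := fun I k => I.Valid k ∧ I.First k ∧ (I.EmptyCore k ∨ ¬I.Disc ∧ ¬I.Shrinks k))
    (N := fun I k => if I.Bad k then numLt I.Pend I.n else 1) (S := Inst.Single)
    (Inst.decides_valid.and (Inst.decides_first.and (Inst.decides_emptyCore.or
      ((Decides.not Inst.decides_disc).and Inst.decides_shrinks.not))))
    (.cond Inst.decides_bad (.numLt (p := fun I _ => I.Pend) (fun _ _ _ h => h.lt)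
      (Inst.decides_pend.comp (.var 0)) .order) (.const 1))
    (.and (Inst.decides_bad.comp (.var 0)) (.and (Inst.decides_pend.comp (.var 2))
      (.eq (.numLt (p := fun I _ => I.Pend) (fun _ _ _ h => h.lt)
        (Inst.decides_pend.comp (.var 0)) (.var 2)) (.var 1))))
    (fun I R => Minimal I.MatchingCut R) (fun I R hR => hR.1) (fun I R => Inst.minimal_iff)
    (fun I k hk => hk.2.1) (fun I k q => Inst.good_single) (by
      intro I k q q' _ hq hq' he
      by_cases hb : I.Bad k
      · rw [if_pos hb] at hq
        obtain ⟨v, -, hv, rfl⟩ := exists_numLt_eq hq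
        have : I.Single k (numLt I.Pend v) v := ⟨hb, hv, rfl⟩
        rw [he] at this
        exact this.2.2
      · rw [if_neg hb] at hq hq'
        omega)
  -- The number of outputs is at most `B * (B + 1)`: there are at most `B` codes with at most `n +
  -- 1` indices each. The final interval up to halting adds one more delay.
  have hD' : PolyBounded (fun B => (B * (B + 1) + 1) * D B) := by fun_prop
  obtain ⟨c, p, hcp⟩ := exists_fpt_bound hD'
  refine ⟨P, c, p, fun n G => ?_⟩
  obtain ⟨ts, t, he, hc, hlen⟩ := h ⟨n, G⟩
  refine ⟨ts, t, ?_, (le_of_isChain hc).trans (le_trans ?_ (hcp ⟨n, G⟩))⟩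
  · convert he using 1
    ext M
    exact Inst.minimal_isMatchingCut_iff (I := ⟨n, G⟩)
  · rw [zero_add]
    refine Nat.mul_le_mul_right _ (Nat.succ_le_succ ?_)
    rw [hlen]
    have hn : n ≤ (⟨n, G⟩ : Inst).scale := Nat.le_add_right _ _
    refine (length_indexList_le (b := n + 1) fun k _ => ?_).trans
      (Nat.mul_le_mul ?_ (by omega))
    · split_ifs
      · exact (Nat.count_le _).trans n.le_succ
      · exact n.succ_pos
    · have h1 := (⟨n, G⟩ : Inst).card_cover_le
      exact le_trans (Nat.pow_le_pow_right (by omega) (by omega)) (Nat.le_add_left _ _)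

theorem exists_matchingCut_enumeration :
    ∃ (P : RAM.Cmd) (c : ℕ) (p : Polynomial ℕ), ∀ (n : ℕ) (G : SimpleGraph (Fin n)),
      RAM.EnumeratesWithDelay P G {M | G.IsMatchingCut M}
        (2 ^ (c * G.vertexCoverNum.toNat) * p.eval n) := by
  obtain ⟨P, D, hD, h⟩ := exists_enumeration
    (T := fun I k => I.Valid k ∧ I.First k)
    (N := fun I k => I.choices 0 k - ind (I.Bad k))
    (S := fun I k q => I.Sel 0 k (q + ind (I.Bad k)))
    (Inst.decides_valid.and Inst.decides_first)
    (.sub (.prod (g := fun I e x => I.radix 0 (e 0) x) .order .order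
      ((Inst.feasible_radix 0).comp (.var 1) (.var 0))) Inst.decides_bad)
    ((Inst.decides_sel 0).comp (.var 0) (.add (.var 1) (Inst.decides_bad.comp (.var 0))) (.var 2))
    (fun I R => I.MatchingCut R) (fun I R hR => hR) (fun I R => Inst.matchingCut_iff)
    (fun I k hk => hk.2) (fun I k q => Inst.good_sel) (by
      intro I k q q' _ hq hq' he
      have := Inst.sel_injective (by omega) (by omega) (by omega) he
      omega)
  refine exists_delay (P := P) hD (F := fun I => {M | I.G.IsMatchingCut M}) fun I => ?_
  obtain ⟨ts, t, he, hc, -⟩ := h I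
  refine ⟨ts, t, ?_, hc⟩
  convert he using 1
  ext M
  exact Inst.isMatchingCut_iff

theorem exists_maximal_enumeration :
    ∃ (P : RAM.Cmd) (c : ℕ) (p : Polynomial ℕ), ∀ (n : ℕ) (G : SimpleGraph (Fin n)),
      RAM.EnumeratesWithDelay P G {M | Maximal G.IsMatchingCut M}
        (2 ^ (c * G.vertexCoverNum.toNat) * p.eval n) := by
  obtain ⟨P, D, hD, h⟩ := exists_enumeration
    (T := fun I k => I.Valid k ∧ I.First k ∧ ¬I.Extends k ∧ (I.Bad k → ∃ v < I.n, I.Pend v))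
    (N := fun I k => I.choices 1 k) (S := fun I k q => I.Sel 1 k q)
    (Inst.decides_valid.and (Inst.decides_first.and (Inst.decides_extends.not.and
      (Inst.decides_bad.imp (.exists_vertex (Inst.decides_pend.comp (.var 0)))))))
    (.prod (g := fun I e x => I.radix 1 (e 0) x) .order .order
      ((Inst.feasible_radix 1).comp (.var 1) (.var 0)))
    (Inst.decides_sel 1)
    (fun I R => Maximal I.MatchingCut R) (fun I R hR => hR.1) (fun I R => Inst.maximal_iff)
    (fun I k hk => hk.2.1) (fun I k q => Inst.good_sel)
    (fun I k q q' _ hq hq' he => Inst.sel_injective le_rfl hq hq' he)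
  refine exists_delay (P := P) hD (F := fun I => {M | Maximal I.G.IsMatchingCut M}) fun I => ?_
  obtain ⟨ts, t, he, hc, -⟩ := h I
  refine ⟨ts, t, ?_, hc⟩
  convert he using 1
  ext M
  exact Inst.maximal_isMatchingCut_iff

end RAM

theorem theorem4p4 :
    -- minimal matching cuts, total time
    (∃ (P : RAM.Cmd) (c : ℕ) (p : Polynomial ℕ), ∀ (n : ℕ) (G : SimpleGraph (Fin n)),
      RAM.EnumeratesInTime P G {M | Minimal G.IsMatchingCut M}
        (2 ^ (c * G.vertexCoverNum.toNat) * p.eval n)) ∧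
    -- all matching cuts, delay
    (∃ (P : RAM.Cmd) (c : ℕ) (p : Polynomial ℕ), ∀ (n : ℕ) (G : SimpleGraph (Fin n)),
      RAM.EnumeratesWithDelay P G {M | G.IsMatchingCut M}
        (2 ^ (c * G.vertexCoverNum.toNat) * p.eval n)) ∧
    -- maximal matching cuts, delay
    (∃ (P : RAM.Cmd) (c : ℕ) (p : Polynomial ℕ), ∀ (n : ℕ) (G : SimpleGraph (Fin n)),
      RAM.EnumeratesWithDelay P G {M | Maximal G.IsMatchingCut M}
        (2 ^ (c * G.vertexCoverNum.toNat) * p.eval n)) :=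
  ⟨RAM.exists_minimal_enumeration, RAM.exists_matchingCut_enumeration,
    RAM.exists_maximal_enumeration⟩
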